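/- Base stations (BSs) are located at the points $x_i$ of a homogeneous Poisson point process $\Phi$ in $\mathbb{R}^2$ with density $\lambda>0$; the channel power gains $g_{x_i}$ are i.i.d. exponential with mean $1$ (Rayleigh fading), independent of $\Phi$. All BSs have height $h\ge 0$, there is a single pathloss exponent $\alpha>2$, and $\ell(r,h)=(r^2+h^2)^{-\alpha/2}$. For the typical user at the origin, the signal-to-interference ratio with serving BS $x\in\Phi$ is $$\mathrm{SIR}_x=\frac{g_x\,\ell(\|x\|,h)}{\sum_{y\in\Phi\setminus\{x\}}g_y\,\ell(\|y\|,h)} .$$ For a threshold $\theta>0$ the coverage probability is $\Pr[\mathrm{SIR}_x>\theta]$, where $x$ is the BS closest to the origin (closest association, $P^{(C)}_{\mathrm{cov}}(\theta,\lambda)$) or the BS with the highest SIR (strongest association, $P^{(S)}_{\mathrm{cov}}(\theta,\lambda)$). Let $\eta(s,m,r)={}_2F_1\big(m,-\tfrac{2}{\alpha};1-\tfrac{2}{\alpha};-\tfrac{s}{m r^{\alpha}}\big)$ with the Gauss hypergeometric function ${}_2F_1$ (analytically continued to the negative real axis). Theorem. (a) For every $h\ge 0$ and $\theta>0$, $$P^{(C)}_{\mathrm{cov}}(\theta,\lambda)=\frac{1}{\eta(\theta,1,1)}\exp\!\big(-\pi\lambda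 h^2(\eta(\theta,1,1)-1)\big);$$ in particular the first factor is the coverage probability for $h=0$. (b) For every $h>0$ and $\theta>0$, the integral $$J(\theta,\lambda)=2\pi\lambda\int_h^\infty \exp\!\big(-\pi\lambda h^2(\eta(\theta r^\alpha,1,h)-1)\big)\,r\,dr$$ is finite and equals the expected number of BSs $x\in\Phi$ with $\mathrm{SIR}_x>\theta$. If moreover $\theta\ge 1$, then $P^{(S)}_{\mathrm{cov}}(\theta,\lambda)=J(\theta,\lambda)$. -/

import Mathlib

open MeasureTheory ProbabilityTheory
open scoped ENNReal NNReal

noncomputable section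

/-- The plane `ℝ²` with its Euclidean norm and Lebesgue measure. -/
abbrev Plane : Type := EuclideanSpace ℝ (Fin 2)

/-- The number of points of the configuration `{x i ω : i ∈ ℕ}` (counted with multiplicity)
that fall in `B`. -/
def pointCount {Ω : Type*} (x : ℕ → Ω → Plane) (B : Set Plane) (ω : Ω) : ℕ∞ :=
  Set.encard {i : ℕ | x i ω ∈ B}

/-- The random points `x 0, x 1, …` (in an arbitrary enumeration) form a homogeneous Poisson point
process in the plane with density `lam`: the number of points in every Borel set `B` of finite area
is Poisson distributed with mean `lam * |B|`, and the numbers of points in finitely many pairwise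
disjoint such sets are independent. -/
structure IsHomogeneousPPP {Ω : Type*} [MeasurableSpace Ω] (P : Measure Ω) (lam : ℝ≥0)
    (x : ℕ → Ω → Plane) : Prop where
  measurable_point : ∀ i, Measurable (x i)
  count_law : ∀ B : Set Plane, MeasurableSet B → volume B < ∞ →
    HasLaw (pointCount x B)
      ((poissonMeasure (lam * (volume B).toNNReal)).map (fun n : ℕ => (n : ℕ∞))) P
  count_indep : ∀ (n : ℕ) (B : Fin n → Set Plane), (∀ j, MeasurableSet (B j)) →
    (∀ j, volume (B j) < ∞) → Pairwise (fun j k => Disjoint (B j) (B k)) →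
    iIndepFun (fun j => pointCount x (B j)) P

/-- The marked Poisson point process `{(x i, g i)}` of base stations: the locations form a
homogeneous Poisson point process with density `lam`, and, independently of the locations, the
channel power fading gains are i.i.d. exponential with unit mean (Rayleigh fading). -/
structure IsRayleighMarkedPPP {Ω : Type*} [MeasurableSpace Ω] (P : Measure Ω) (lam : ℝ≥0)
    (x : ℕ → Ω → Plane) (g : ℕ → Ω → ℝ) : Prop where
  ppp : IsHomogeneousPPP P lam x
  measurable_gain : ∀ i, Measurable (g i)
  gain_law : ∀ i, HasLaw (g i) (expMeasure 1) P
  gain_indep : iIndepFun g P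
  indep : IndepFun (fun ω i => x i ω) (fun ω i => g i ω) P

/-- Pathloss at horizontal distance `r` from a base station at height `h`. -/
def pathloss (α h r : ℝ) : ℝ := (r ^ 2 + h ^ 2) ^ (-(α / 2))

/-- Power received at the origin from base station `i`. -/
def receivedPower {Ω : Type*} (α h : ℝ) (x : ℕ → Ω → Plane) (g : ℕ → Ω → ℝ) (i : ℕ) (ω : Ω) :
    ℝ≥0∞ :=
  ENNReal.ofReal (g i ω * pathloss α h ‖x i ω‖)

/-- Aggregate interference power when base station `i` is the serving one. -/
def interference {Ω : Type*} (α h : ℝ) (x : ℕ → Ω → Plane) (g : ℕ → Ω → ℝ) (i : ℕ) (ω : Ω) :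
    ℝ≥0∞ :=
  ∑' j : {j : ℕ // j ≠ i}, receivedPower α h x g j ω

/-- Signal-to-interference ratio at the origin when base station `i` is the serving one. -/
def sir {Ω : Type*} (α h : ℝ) (x : ℕ → Ω → Plane) (g : ℕ → Ω → ℝ) (i : ℕ) (ω : Ω) : ℝ≥0∞ :=
  receivedPower α h x g i ω / interference α h x g i ω

/-- Base station `i` is closest to the origin. -/
def IsClosest {Ω : Type*} (x : ℕ → Ω → Plane) (i : ℕ) (ω : Ω) : Prop :=
  ∀ j, ‖x i ω‖ ≤ ‖x j ω‖

/-- Base station `i` offers the highest signal-to-interference ratio. -/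
def IsStrongest {Ω : Type*} (α h : ℝ) (x : ℕ → Ω → Plane) (g : ℕ → Ω → ℝ) (i : ℕ) (ω : Ω) :
    Prop :=
  ∀ j, sir α h x g j ω ≤ sir α h x g i ω

/-- Coverage probability with closest base station association: the probability that the SIR
offered by the closest base station is larger than the threshold `θ`. -/
def coverageClosest {Ω : Type*} [MeasurableSpace Ω] (P : Measure Ω) (α h : ℝ)
    (x : ℕ → Ω → Plane) (g : ℕ → Ω → ℝ) (θ : ℝ) : ℝ :=
  P.real {ω | ∃ i, IsClosest x i ω ∧ ENNReal.ofReal θ < sir α h x g i ω}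

/-- Coverage probability with strongest base station association: the probability that the SIR
offered by the base station with the highest SIR is larger than the threshold `θ`. -/
def coverageStrongest {Ω : Type*} [MeasurableSpace Ω] (P : Measure Ω) (α h : ℝ)
    (x : ℕ → Ω → Plane) (g : ℕ → Ω → ℝ) (θ : ℝ) : ℝ :=
  P.real {ω | ∃ i, IsStrongest α h x g i ω ∧ ENNReal.ofReal θ < sir α h x g i ω}

/-- Expected number of base stations whose SIR is larger than the threshold `θ`. -/
def meanCoveringStations {Ω : Type*} [MeasurableSpace Ω] (P : Measure Ω) (α h : ℝ)
    (x : ℕ → Ω → Plane) (g : ℕ → Ω → ℝ) (θ : ℝ) : ℝ≥0∞ :=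
  ∫⁻ ω, (({i : ℕ | ENNReal.ofReal θ < sir α h x g i ω}.encard : ℕ∞) : ℝ≥0∞) ∂P

/-- The Gauss hypergeometric function `₂F₁(a, b; c; z)` at real `z < 1`: the hypergeometric series
for `|z| < 1` and its analytic continuation to `z ≤ -1`, written with the Pfaff transformation
`₂F₁(a, b; c; z) = (1 - z)^(-a) ₂F₁(a, c - b; c; z / (z - 1))`, where `0 < z / (z - 1) < 1`. -/
def gaussHypergeometric (a b c z : ℝ) : ℝ :=
  if |z| < 1 then ordinaryHypergeometric a b c z
  else (1 - z) ^ (-a) * ordinaryHypergeometric a (c - b) c (z / (z - 1))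

/-- `η(s, m, r) = ₂F₁(m, -2/α; 1 - 2/α; -s / (m r^α))`. -/
def eta (α s m r : ℝ) : ℝ :=
  gaussHypergeometric m (-(2 / α)) (1 - 2 / α) (-(s / (m * r ^ α)))

end

/-! Only distances to the origin enter the SIR, and the squared distances `T i = ‖x i‖ ^ 2` form a
Poisson process on the half-line with constant intensity `μ = π λ`. Given the locations, station `i`
covers the origin iff `g i` exceeds `Y = ∑_{j ≠ i} g j c_j` with `c_j = θ ℓ_j / ℓ_i`; by Rayleigh
fading this has probability `E exp(-Y) = ∏_{j ≠ i} 1 / (1 + c_j)` (`measure_tsum_lt_eq_prodNe`).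

Summing over `i`, both parts reduce to Mecke's formula `E ∑_i ∏_{j ≠ i} F(T i, T j) = ∫ μ exp(-μ ∫
(1 - F(s, t)) dt) ds` (`lintegral_tsum_prodNe`). It is derived from the counts alone: for a kernel
constant on dyadic cells it amounts to computing `E c^N` and `E N c^(N-1)` for independent Poisson
counts, and a general `F` is approximated from above by such kernels.

In (b), `F(s, t) = 1 / (1 + θ ((s + h²) / (t + h²))^β)` with `β = α / 2`; in (a) this `F` is set to
`0` for `t < s`, which kills the product unless `i` is closest. Scaling reduces the inner integral
to `∫_1^∞ s / (s + u^β) du`, which is a hypergeometric value minus one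
(`gaussHypergeometric_eq_one_add_integral`). In (a) the exponent is then affine in `s` and the outer
integral elementary; in (b) `s = r² - h²` yields `J`. For `θ ≥ 1` at most one station covers the
origin, so the mean number of covering stations is a probability. -/

noncomputable section

/-! ### Poisson counts -/

lemma lintegral_comp_of_hasLaw_poisson {Ω : Type*} [MeasurableSpace Ω] {P : Measure Ω} {m : ℝ≥0}
    {N : Ω → ℕ∞} (hN : HasLaw N ((poissonMeasure m).map (fun n : ℕ => (n : ℕ∞))) P)
    (ψ : ℕ∞ → ℝ≥0∞) :
    ∫⁻ ω, ψ (N ω) ∂P = ∑' n : ℕ, ENNReal.ofReal (Real.exp (-m) * m ^ n / n.factorial) * ψ n := by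
  rw [hN.lintegral_comp Measurable.of_discrete.aemeasurable,
    lintegral_map Measurable.of_discrete Measurable.of_discrete, poissonMeasure,
    lintegral_sum_measure]
  simp [lintegral_smul_measure]

lemma tsum_poisson_mul_pow (m : ℝ≥0) {c : ℝ} (hc : 0 ≤ c) :
    ∑' n : ℕ, ENNReal.ofReal (Real.exp (-m) * m ^ n / n.factorial) * ENNReal.ofReal (c ^ n) =
      ENNReal.ofReal (Real.exp (-(m * (1 - c)))) := by
  have h : HasSum (fun n : ℕ => Real.exp (-m) * ((m * c) ^ n / n.factorial))
      (Real.exp (-m) * Real.exp (m * c)) := by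
    rw [Real.exp_eq_exp_ℝ]
    exact (NormedSpace.expSeries_div_hasSum_exp ((m : ℝ) * c)).mul_left _
  rw [← Real.exp_add] at h
  rw [show (-((m : ℝ) * (1 - c))) = -m + m * c by ring, ← h.tsum_eq,
    ENNReal.ofReal_tsum_of_nonneg (fun n => by positivity) h.summable]
  refine tsum_congr fun n => ?_
  rw [← ENNReal.ofReal_mul (by positivity)]
  congr 1
  rw [mul_pow]; ring

/-- Derivative in `c` of the generating function, obtained by an index shift. The factor `n` kills
the term `n = 0`, so the truncated `n - 1` is harmless. -/
lemma tsum_poisson_mul_pow_pred (m : ℝ≥0) {c : ℝ} (hc : 0 ≤ c) :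
    ∑' n : ℕ, ENNReal.ofReal (Real.exp (-m) * m ^ n / n.factorial) *
      (n * ENNReal.ofReal (c ^ (n - 1))) =
      m * ENNReal.ofReal (Real.exp (-(m * (1 - c)))) := by
  rw [tsum_eq_zero_add' ENNReal.summable, ← tsum_poisson_mul_pow m hc, ← ENNReal.tsum_mul_left]
  simp only [Nat.cast_zero, zero_mul, mul_zero, zero_add, Nat.add_sub_cancel]
  refine tsum_congr fun n => ?_
  have hc' : 0 ≤ c ^ n := pow_nonneg hc n
  rw [← mul_assoc, ← mul_assoc, ← ENNReal.ofReal_natCast, ← ENNReal.ofReal_coe_nnreal]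
  congr 1
  rw [← ENNReal.ofReal_mul (by positivity), ← ENNReal.ofReal_mul (by positivity)]
  congr 1
  rw [Nat.factorial_succ, pow_succ]
  push_cast
  field_simp

/-! ### Products over the points of a configuration -/

/-- The product of `F j` over all `j ≠ i`, for factors in `[0, 1]`. -/
def prodNe (F : ℕ → ℝ) (i : ℕ) : ℝ≥0∞ :=
  ⨅ N : ℕ, ENNReal.ofReal (∏ j ∈ (Finset.range N).erase i, F j)

lemma prodNe_le_one (F : ℕ → ℝ) (i : ℕ) :
    prodNe F i ≤ 1 :=
  (iInf_le _ 0).trans (by simp)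

/-- Factors in `[0, 1]` make the partial products decrease, and the infimum is attained once the
range contains `J`. -/
lemma prodNe_eq_of_finite {F : ℕ → ℝ} (h0 : ∀ j, 0 ≤ F j) (h1 : ∀ j, F j ≤ 1) {J : Finset ℕ}
    (hJ : ∀ j ∉ J, F j = 1) (i : ℕ) :
    prodNe F i = ENNReal.ofReal (∏ j ∈ J.erase i, F j) := by
  apply le_antisymm
  · refine (iInf_le _ (J.sup id + 1)).trans (le_of_eq ?_)
    congr 1
    symm
    apply Finset.prod_subset
    · apply Finset.erase_subset_erase
      intro j hj
      exact Finset.mem_range.2 (Nat.lt_succ_of_le (Finset.le_sup (f := id) hj))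
    · intro j hj hj'
      refine hJ j fun h => hj' (Finset.mem_erase.2 ⟨(Finset.mem_erase.1 hj).1, h⟩)
  · refine le_iInf fun N => ENNReal.ofReal_le_ofReal ?_
    have e : ∏ j ∈ J.erase i ∪ (Finset.range N).erase i, F j = ∏ j ∈ J.erase i, F j := by
      symm
      apply Finset.prod_subset Finset.subset_union_left
      intro j hj hj'
      refine hJ j fun h => hj' (Finset.mem_erase.2 ⟨?_, h⟩)
      simp only [Finset.mem_union, Finset.mem_erase] at hj
      tauto
    rw [← e]
    rw [← Finset.prod_sdiff (Finset.subset_union_right (s₁ := J.erase i))]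
    exact mul_le_of_le_one_left (Finset.prod_nonneg fun j _ => h0 j)
      (Finset.prod_le_one (fun j _ => h0 j) fun j _ => h1 j)

/-- All indices in cell `k` contribute the same product: omitting one of them lowers the exponent of
`f k` by one and leaves the other cells alone. The number of such indices gives the extra factor. -/
lemma tsum_prodNe_cell {κ : ℕ → ℕ} {f : ℕ → ℝ} (h0 : ∀ l, 0 ≤ f l) (h1 : ∀ l, f l ≤ 1) {L k : ℕ}
    (hk : k < L) (hf : ∀ l, L ≤ l → f l = 1) (hfin : ∀ l < L, {i | κ i = l}.Finite) :
    ∑' i, {i | κ i = k}.indicator (prodNe (fun j => f (κ j))) i =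
      ∏ l ∈ Finset.range L, if l = k then
        {i | κ i = l}.ncard * ENNReal.ofReal (f l ^ ({i | κ i = l}.ncard - 1))
        else ENNReal.ofReal (f l ^ {i | κ i = l}.ncard) := by
  have hJfin : {i | κ i < L}.Finite := by
    have : {i | κ i < L} = ⋃ l ∈ Finset.range L, {i | κ i = l} := by ext; simp
    rw [this]
    exact Set.Finite.biUnion (Finset.finite_toSet _) fun l hl => hfin l (by simpa using hl)
  set J := hJfin.toFinset with hJ
  have hJm : ∀ i, i ∈ J ↔ κ i < L := fun i => by simp [hJ]
  have hcard : ∀ l < L, {i | κ i = l}.ncard = (J.filter fun i => κ i = l).card := by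
    intro l hl
    rw [← Set.ncard_coe_finset]
    congr 1
    ext i
    simp only [Set.mem_ofPred_eq, Finset.coe_filter, hJm]
    exact ⟨fun h => ⟨h ▸ hl, h⟩, fun h => h.2⟩
  have key : ∀ i, κ i = k → prodNe (fun j => f (κ j)) i = ENNReal.ofReal
      (∏ l ∈ Finset.range L, if l = k then f l ^ ({i | κ i = l}.ncard - 1)
        else f l ^ {i | κ i = l}.ncard) := by
    intro i hi
    rw [prodNe_eq_of_finite (fun j => h0 _) (fun j => h1 _) (J := J)
      (fun j hj => hf _ (by simpa [hJm] using hj))]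
    congr 1
    rw [← Finset.prod_fiberwise_of_maps_to (t := Finset.range L) (g := κ)
      (fun j hj => by simpa [hJm] using (Finset.mem_of_mem_erase hj))]
    refine Finset.prod_congr rfl fun l hl => ?_
    rw [Finset.prod_congr rfl (g := fun _ => f l)
      (fun j hj => by rw [(Finset.mem_filter.1 hj).2]), Finset.prod_const, Finset.filter_erase,
      hcard l (by simpa using hl)]
    split_ifs with h
    · rw [Finset.card_erase_of_mem]
      simp [hJm, hi, h, hk]
    · rw [Finset.erase_eq_of_notMem]
      simp [hi, Ne.symm h]
  have e : ∀ i, {i | κ i = k}.indicator (prodNe (fun j => f (κ j))) i =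
      {i | κ i = k}.indicator (fun _ => ENNReal.ofReal
      (∏ l ∈ Finset.range L, if l = k then f l ^ ({i | κ i = l}.ncard - 1)
        else f l ^ {i | κ i = l}.ncard)) i := by
    intro i
    by_cases h : κ i = k
    · simp only [Set.indicator, Set.mem_ofPred_eq, h, if_true]
      exact key i h
    · simp [Set.indicator, h]
  rw [tsum_congr e, ← tsum_subtype, ENNReal.tsum_set_const,
    ENNReal.ofReal_prod_of_nonneg (fun l _ => by split_ifs <;> exact pow_nonneg (h0 _) _),
    ← Finset.mul_prod_erase _ _ (Finset.mem_range.2 hk),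
    ← Finset.mul_prod_erase _ _ (Finset.mem_range.2 hk), if_pos rfl, if_pos rfl, ← mul_assoc,
    ← (hfin k hk).cast_ncard_eq]
  congr 1
  refine Finset.prod_congr rfl fun l hl => ?_
  rw [if_neg (Finset.ne_of_mem_erase hl), if_neg (Finset.ne_of_mem_erase hl)]

/-- Mecke's formula for a configuration observed through finitely many cells with independent
Poisson counts. -/
lemma lintegral_tsum_prodNe_cell {Ω : Type*} [MeasurableSpace Ω] {P : Measure Ω}
    {κ : ℕ → Ω → ℕ} (hκ : ∀ i, Measurable (κ i)) {m : ℝ≥0} {L : ℕ}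
    (hlaw : ∀ l < L, HasLaw (fun ω => {i | κ i ω = l}.encard)
      ((poissonMeasure m).map (fun n : ℕ => (n : ℕ∞))) P)
    (hind : iIndepFun (fun (l : Fin L) ω => {i | κ i ω = l}.encard) P)
    {f : ℕ → ℝ} (h0 : ∀ l, 0 ≤ f l) (h1 : ∀ l, f l ≤ 1) {k : ℕ}
    (hk : k < L) (hf : ∀ l, L ≤ l → f l = 1) :
    ∫⁻ ω, ∑' i, {i | κ i ω = k}.indicator (prodNe (fun j => f (κ j ω))) i ∂P =
      m * ENNReal.ofReal (Real.exp (-∑ l ∈ Finset.range L, m * (1 - f l))) := by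
  have hmeas : ∀ l, Measurable fun ω => {i | κ i ω = l}.encard := fun l =>
    measurable_encard.comp (measurable_set_iff.2 fun i => by
      exact measurable_to_prop (by simpa [Set.preimage] using hκ i (measurableSet_singleton l)))
  -- The Poisson law on `ℕ∞` does not charge `⊤`; testing it with the indicator of `⊤` shows that
  -- the cells are almost surely finite.
  have hfin : ∀ᵐ ω ∂P, ∀ l < L, {i | κ i ω = l}.Finite := by
    rw [ae_all_iff]
    intro l
    by_cases hl : l < L
    · let φ : ℕ∞ → ℝ≥0∞ := fun n => if n = ⊤ then 1 else 0
      have h : ∫⁻ ω, φ {i | κ i ω = l}.encard ∂P = _ :=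
        lintegral_comp_of_hasLaw_poisson (hlaw l hl) φ
      rw [tsum_congr (g := fun _ => 0) (fun n => by simp [φ]), tsum_zero] at h
      have hφ : Measurable fun ω => φ {i | κ i ω = l}.encard :=
        (Measurable.of_discrete : Measurable φ).comp (hmeas l)
      filter_upwards [(lintegral_eq_zero_iff hφ).1 h] with ω hω _
      rw [← Set.encard_ne_top_iff]
      intro h'
      simp [φ, h'] at hω
    · exact Filter.Eventually.of_forall fun ω h => absurd h hl
  let ψ : ℕ → ℕ∞ → ℝ≥0∞ := fun l n => if l = k then
        n.toNat * ENNReal.ofReal (f l ^ (n.toNat - 1))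
        else ENNReal.ofReal (f l ^ n.toNat)
  have e : ∀ᵐ ω ∂P, ∑' i, {i | κ i ω = k}.indicator (prodNe (fun j => f (κ j ω))) i =
      ∏ l : Fin L, ψ l {i | κ i ω = l}.encard := by
    filter_upwards [hfin] with ω hω
    rw [tsum_prodNe_cell h0 h1 hk hf hω, Finset.prod_range]
    rfl
  rw [lintegral_congr_ae e, lintegral_prod_eq_prod_lintegral_of_indepFun _
    (fun (l : Fin L) ω => ψ l {i | κ i ω = l}.encard)
    (hind.comp (fun l => ψ l) fun l => Measurable.of_discrete)
    (fun l => (Measurable.of_discrete : Measurable (ψ l)).comp (hmeas l)),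
    Finset.prod_congr rfl (fun (l : Fin L) _ => lintegral_comp_of_hasLaw_poisson (hlaw l l.2) (ψ l))]
  have e2 : ∀ l : Fin L, ∑' n : ℕ, ENNReal.ofReal (Real.exp (-m) * m ^ n / n.factorial) * ψ l n =
      (if (l : ℕ) = k then (m : ℝ≥0∞) else 1) * ENNReal.ofReal (Real.exp (-(m * (1 - f l)))) := by
    intro l
    by_cases h : (l : ℕ) = k
    · simp only [ψ, h, if_true, ENat.toNat_natCast]
      exact tsum_poisson_mul_pow_pred m (h0 k)
    · simp only [ψ, h, if_false, ENat.toNat_natCast, one_mul]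
      exact tsum_poisson_mul_pow m (h0 l)
  rw [Finset.prod_congr rfl (fun l _ => e2 l), Finset.prod_mul_distrib,
    ← ENNReal.ofReal_prod_of_nonneg (fun _ _ => (Real.exp_pos _).le), ← Real.exp_sum,
    ← Finset.sum_neg_distrib, Finset.sum_range, Finset.prod_eq_single (⟨k, hk⟩ : Fin L)]
  · simp
  · intro b _ hb
    rw [if_neg]
    intro h
    exact hb (Fin.ext h)
  · simp

/-! ### Dyadic cells -/

/-- The left end point of the dyadic cell of order `n` that contains `s`. -/
def dyadicLo (n : ℕ) (s : ℝ) : ℝ := ⌊2 ^ n * s⌋₊ / 2 ^ n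

/-- The right end point of the dyadic cell of order `n` that contains `s`. -/
def dyadicHi (n : ℕ) (s : ℝ) : ℝ := (⌊2 ^ n * s⌋₊ + 1) / 2 ^ n

lemma dyadicLo_nonneg (n : ℕ) (s : ℝ) : 0 ≤ dyadicLo n s := by unfold dyadicLo; positivity

lemma dyadicHi_nonneg (n : ℕ) (s : ℝ) : 0 ≤ dyadicHi n s := by unfold dyadicHi; positivity

lemma dyadicLo_le (n : ℕ) {s : ℝ} (hs : 0 ≤ s) : dyadicLo n s ≤ s := by
  rw [dyadicLo, div_le_iff₀' (by positivity)]
  exact Nat.floor_le (by positivity)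

lemma lt_dyadicHi (n : ℕ) (s : ℝ) : s < dyadicHi n s := by
  rw [dyadicHi, lt_div_iff₀' (by positivity)]
  exact Nat.lt_floor_add_one _

lemma dyadicHi_eq (n : ℕ) (s : ℝ) : dyadicHi n s = dyadicLo n s + (1 / 2) ^ n := by
  rw [dyadicHi, dyadicLo, add_div, one_div_pow]

lemma dyadicLo_mono {s : ℝ} (hs : 0 ≤ s) : Monotone fun n => dyadicLo n s := by
  refine monotone_nat_of_le_succ fun n => ?_
  unfold dyadicLo
  rw [div_le_div_iff₀ (by positivity) (by positivity), pow_succ, ← mul_assoc, mul_comm _ (2 : ℝ),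
    ← mul_assoc]
  refine mul_le_mul_of_nonneg_right ?_ (by positivity)
  have : 2 * ⌊2 ^ n * s⌋₊ ≤ ⌊2 ^ n * 2 * s⌋₊ := by
    rw [Nat.le_floor_iff (by positivity)]
    push_cast
    nlinarith [Nat.floor_le (show 0 ≤ 2 ^ n * s by positivity)]
  exact_mod_cast this

lemma dyadicHi_anti {s : ℝ} (hs : 0 ≤ s) : Antitone fun n => dyadicHi n s := by
  refine antitone_nat_of_succ_le fun n => ?_
  unfold dyadicHi
  have : ⌊2 ^ (n + 1) * s⌋₊ < 2 * (⌊2 ^ n * s⌋₊ + 1) := by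
    rw [Nat.floor_lt (by positivity), pow_succ]
    push_cast
    nlinarith [Nat.lt_floor_add_one (2 ^ n * s)]
  have h : (⌊2 ^ (n + 1) * s⌋₊ : ℝ) + 1 ≤ 2 * (⌊2 ^ n * s⌋₊ + 1) := by exact_mod_cast this
  rw [div_le_iff₀ (by positivity)]
  refine h.trans_eq ?_
  rw [pow_succ (2 : ℝ) n]
  field_simp

lemma tendsto_dyadicLo {s : ℝ} (hs : 0 ≤ s) :
    Filter.Tendsto (fun n => dyadicLo n s) Filter.atTop (nhds s) := by
  have h : Filter.Tendsto (fun n : ℕ => s - (1 / 2 : ℝ) ^ n) Filter.atTop (nhds (s - 0)) :=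
    tendsto_const_nhds.sub (tendsto_pow_atTop_nhds_zero_of_lt_one (by norm_num) (by norm_num))
  rw [sub_zero] at h
  refine tendsto_of_tendsto_of_tendsto_of_le_of_le h tendsto_const_nhds (fun n => ?_)
    fun n => dyadicLo_le n hs
  have := lt_dyadicHi n s
  rw [dyadicHi_eq] at this
  simp only
  linarith

lemma tendsto_dyadicHi {s : ℝ} (hs : 0 ≤ s) :
    Filter.Tendsto (fun n => dyadicHi n s) Filter.atTop (nhds s) := by
  simp_rw [dyadicHi_eq]
  simpa using (tendsto_dyadicLo hs).add
    (tendsto_pow_atTop_nhds_zero_of_lt_one (𝕜 := ℝ) (r := 1 / 2) (by norm_num) (by norm_num))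

lemma floor_lt_iff_lt (n M : ℕ) {s : ℝ} (hs : 0 ≤ s) : ⌊2 ^ n * s⌋₊ < M * 2 ^ n ↔ s < M := by
  rw [Nat.floor_lt (by positivity)]
  push_cast
  rw [mul_comm (M : ℝ), mul_lt_mul_iff_right₀ (by positivity)]

/-- Turns the sums over cells of the discrete Mecke formula into integrals of step functions. -/
lemma lintegral_Ico_floor (n K : ℕ) (G : ℕ → ℝ≥0∞) :
    ∫⁻ s in Set.Ico (0 : ℝ) (K / 2 ^ n), G ⌊2 ^ n * s⌋₊ =
      ∑ k ∈ Finset.range K, ENNReal.ofReal (1 / 2 ^ n) * G k := by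
  induction K with
  | zero => simp
  | succ K ih =>
    have h1 : (0 : ℝ) ≤ K / 2 ^ n := by positivity
    have h2 : (K : ℝ) / 2 ^ n ≤ (K + 1 : ℕ) / 2 ^ n := by push_cast; gcongr; linarith
    rw [← Set.Ico_union_Ico_eq_Ico h1 h2, lintegral_union measurableSet_Ico
      (Set.disjoint_left.2 fun s hs hs' => not_lt_of_ge hs'.1 hs.2), ih, Finset.sum_range_succ]
    congr 1
    rw [setLIntegral_congr_fun (g := fun _ => G K) measurableSet_Ico, setLIntegral_const,
      Real.volume_Ico, mul_comm]
    · congr 2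
      push_cast
      ring
    · intro s hs
      have hs0 : 0 ≤ s := h1.trans hs.1
      have : ⌊2 ^ n * s⌋₊ = K := by
        rw [Nat.floor_eq_iff (by positivity)]
        rw [Set.mem_Ico, div_le_iff₀' (by positivity), lt_div_iff₀' (by positivity)] at hs
        push_cast at hs
        exact hs
      simp only [this]

/-! ### The squared distances form a Poisson process on the half-line -/

/-- The points `T 0, T 1, …` of the half-line have independent Poisson counts with density `μ` in
the dyadic cells of every order. -/
structure IsDyadicPoisson {Ω : Type*} [MeasurableSpace Ω] (P : Measure Ω) (μ : ℝ≥0)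
    (T : ℕ → Ω → ℝ) : Prop where
  measurable : ∀ i, Measurable (T i)
  nonneg : ∀ i ω, 0 ≤ T i ω
  law : ∀ n l : ℕ, HasLaw (fun ω => {i | ⌊2 ^ n * T i ω⌋₊ = l}.encard)
    ((poissonMeasure (μ / 2 ^ n)).map (fun n : ℕ => (n : ℕ∞))) P
  indep : ∀ n L : ℕ, iIndepFun (fun (l : Fin L) ω => {i | ⌊2 ^ n * T i ω⌋₊ = l}.encard) P

lemma setOf_floor_norm_sq_eq (n l : ℕ) :
    {p : Plane | ⌊2 ^ n * ‖p‖ ^ 2⌋₊ = l} =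
      Metric.ball 0 √((l + 1) / 2 ^ n) \ Metric.ball 0 √(l / 2 ^ n) := by
  ext p
  simp only [Set.mem_ofPred_eq, Set.mem_sdiff, mem_ball_zero_iff, not_lt]
  rw [Nat.floor_eq_iff (by positivity), Real.lt_sqrt (norm_nonneg _),
    Real.sqrt_le_left (norm_nonneg _), div_le_iff₀' (by positivity), lt_div_iff₀' (by positivity)]
  tauto

/-- An annulus with squared radii `a < b` has area `π (b - a)`, so the squared distance is the
coordinate in which the process is homogeneous. -/
lemma volume_setOf_floor_norm_sq_eq (n l : ℕ) :
    volume {p : Plane | ⌊2 ^ n * ‖p‖ ^ 2⌋₊ = l} = ENNReal.ofReal (Real.pi / 2 ^ n) := by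
  have hle : √((l : ℝ) / 2 ^ n) ≤ √((l + 1) / 2 ^ n) := by
    apply Real.sqrt_le_sqrt; gcongr; linarith
  rw [setOf_floor_norm_sq_eq, measure_sdiff (Metric.ball_subset_ball hle)
    measurableSet_ball.nullMeasurableSet (by finiteness), EuclideanSpace.volume_ball_fin_two,
    EuclideanSpace.volume_ball_fin_two, ← ENNReal.ofReal_pow (by positivity),
    ← ENNReal.ofReal_pow (by positivity), Real.sq_sqrt (by positivity), Real.sq_sqrt (by positivity),
    ← ENNReal.ofReal_mul (by positivity), ← ENNReal.ofReal_mul (by positivity),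
    ← ENNReal.ofReal_sub _ (by positivity)]
  congr 1
  ring

lemma IsHomogeneousPPP.isDyadicPoisson {Ω : Type*} [MeasurableSpace Ω] {P : Measure Ω} {lam : ℝ≥0}
    {x : ℕ → Ω → Plane} (h : IsHomogeneousPPP P lam x) :
    IsDyadicPoisson P (lam * Real.toNNReal Real.pi) (fun i ω => ‖x i ω‖ ^ 2) where
  measurable i := (h.measurable_point i).norm.pow_const 2
  nonneg i ω := by positivity
  law n l := by
    have hB : MeasurableSet {p : Plane | ⌊2 ^ n * ‖p‖ ^ 2⌋₊ = l} := by
      rw [setOf_floor_norm_sq_eq]; exact measurableSet_ball.diff measurableSet_ball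
    have := h.count_law _ hB (by rw [volume_setOf_floor_norm_sq_eq]; exact ENNReal.ofReal_lt_top)
    rw [volume_setOf_floor_norm_sq_eq] at this
    have e : lam * Real.toNNReal Real.pi / 2 ^ n =
        lam * (ENNReal.ofReal (Real.pi / 2 ^ n)).toNNReal := by
      rw [mul_div_assoc]
      congr 1
      change _ = Real.toNNReal _
      rw [Real.toNNReal_div Real.pi_pos.le, Real.toNNReal_pow zero_le_two]
      simp
    rw [e]
    exact this
  indep n L := by
    refine h.count_indep L (fun l => {p : Plane | ⌊2 ^ n * ‖p‖ ^ 2⌋₊ = l}) (fun l => ?_)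
      (fun l => ?_) fun j k hjk => ?_
    · simp only [setOf_floor_norm_sq_eq]; exact measurableSet_ball.diff measurableSet_ball
    · simp only [volume_setOf_floor_norm_sq_eq]; exact ENNReal.ofReal_lt_top
    · refine Set.disjoint_left.2 fun p hp hp' => hjk (Fin.ext ?_)
      simp only [Set.mem_ofPred_eq] at hp hp'
      omega

/-! ### Mecke's formula -/

lemma measurable_prodNe {Ω : Type*} [MeasurableSpace Ω] {F : Ω → ℕ → ℝ}
    (hF : ∀ j, Measurable fun ω => F ω j) (i : ℕ) : Measurable fun ω => prodNe (F ω) i :=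
  .iInf fun _ => (Finset.measurable_fun_prod _ fun j _ => hF j).ennreal_ofReal

/-- A `[0, 1]`-valued kernel on the half-line that is decreasing and left-continuous in its first
and increasing and right-continuous in its second argument. -/
structure IsMonotoneKernel (F : ℝ → ℝ → ℝ) : Prop where
  nonneg : ∀ s t, 0 ≤ s → 0 ≤ t → 0 ≤ F s t
  le_one : ∀ s t, 0 ≤ s → 0 ≤ t → F s t ≤ 1
  mono : ∀ s s' t t', 0 ≤ s' → s' ≤ s → 0 ≤ t → t ≤ t' → F s t ≤ F s' t'
  measurable : Measurable (Function.uncurry F)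
  tendsto : ∀ s t, 0 ≤ s → 0 ≤ t →
    Filter.Tendsto (fun n => F (dyadicLo n s) (dyadicHi n t)) Filter.atTop (nhds (F s t))

/-- The approximation of a kernel by a dyadic step function from above. -/
def dyadicKernel (F : ℝ → ℝ → ℝ) (n : ℕ) (s t : ℝ) : ℝ :=
  if t < n then F (dyadicLo n s) (dyadicHi n t) else 1

/-- Once the cell `k` of `T i` is fixed, the kernel depends only on the cell of `T j`, so the cell
formula applies for each `k`. The bound `M ≤ n` keeps these `k` among the `n * 2 ^ n` cells that are
counted. -/
lemma lintegral_tsum_dyadicKernel {Ω : Type*} [MeasurableSpace Ω] {P : Measure Ω} {μ : ℝ≥0}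
    {T : ℕ → Ω → ℝ} (hT : IsDyadicPoisson P μ T) {F : ℝ → ℝ → ℝ} (hF : IsMonotoneKernel F)
    {n M : ℕ} (hM : M ≤ n) :
    ∫⁻ ω, ∑' i, (if T i ω < M then prodNe (fun j => dyadicKernel F n (T i ω) (T j ω)) i else 0) ∂P =
      ∫⁻ s in Set.Ico (0 : ℝ) M, ENNReal.ofReal (μ * Real.exp (-(μ *
        (∫⁻ t in Set.Ici 0, ENNReal.ofReal (1 - dyadicKernel F n s t)).toReal))) := by
  set f : ℕ → ℕ → ℝ := fun k l =>
    if l < n * 2 ^ n then F (k / 2 ^ n) ((l + 1) / 2 ^ n) else 1 with hf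
  have h0 : ∀ k l, 0 ≤ f k l := fun k l => by
    simp only [f]; split_ifs; exacts [hF.nonneg _ _ (by positivity) (by positivity), zero_le_one]
  have h1 : ∀ k l, f k l ≤ 1 := fun k l => by
    simp only [f]; split_ifs; exacts [hF.le_one _ _ (by positivity) (by positivity), le_rfl]
  have hFf : ∀ s t, 0 ≤ t → dyadicKernel F n s t = f ⌊2 ^ n * s⌋₊ ⌊2 ^ n * t⌋₊ := by
    intro s t ht
    simp only [f, dyadicKernel, floor_lt_iff_lt n n ht]
    rfl
  have hκ : ∀ i, Measurable fun ω => ⌊2 ^ n * T i ω⌋₊ := fun i =>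
    Nat.measurable_floor.comp ((hT.measurable i).const_mul _)
  have hsplit : ∀ ω i, (if T i ω < M then prodNe (fun j => dyadicKernel F n (T i ω) (T j ω)) i
      else 0) = ∑ k ∈ Finset.range (M * 2 ^ n), {i | ⌊2 ^ n * T i ω⌋₊ = k}.indicator
        (prodNe fun j => f k ⌊2 ^ n * T j ω⌋₊) i := by
    intro ω i
    simp only [Set.indicator_apply, Set.mem_ofPred_eq, Finset.sum_ite_eq, Finset.mem_range,
      floor_lt_iff_lt n M (hT.nonneg i ω)]
    congr 2
    ext j
    rw [hFf _ _ (hT.nonneg j ω)]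
  have hmeas : ∀ k, Measurable fun ω => ∑' i, {i | ⌊2 ^ n * T i ω⌋₊ = k}.indicator
        (prodNe fun j => f k ⌊2 ^ n * T j ω⌋₊) i := by
    intro k
    refine .tsum fun i => ?_
    simp only [Set.indicator_apply, Set.mem_ofPred_eq]
    refine Measurable.ite (hκ i (measurableSet_singleton k)) (measurable_prodNe (fun j => ?_) i)
      measurable_const
    exact (Measurable.of_discrete : Measurable (f k)).comp (hκ j)
  have hnn : ((n * 2 ^ n : ℕ) : ℝ) / 2 ^ n = n := by push_cast; field_simp
  have hMM : ((M * 2 ^ n : ℕ) : ℝ) / 2 ^ n = M := by push_cast; field_simp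
  have hD : ∀ s, (∫⁻ t in Set.Ici 0, ENNReal.ofReal (1 - dyadicKernel F n s t)) =
      ENNReal.ofReal (∑ l ∈ Finset.range (n * 2 ^ n), 1 / 2 ^ n * (1 - f ⌊2 ^ n * s⌋₊ l)) := by
    intro s
    rw [← Set.Ico_union_Ici_eq_Ici (Nat.cast_nonneg n), lintegral_union measurableSet_Ici
      (Set.disjoint_left.2 fun s hs hs' => not_lt_of_ge hs' hs.2),
      setLIntegral_congr_fun (s := Set.Ici (n : ℝ)) (g := fun _ => 0) measurableSet_Ici
        (fun t ht => by simp [dyadicKernel, not_lt_of_ge (show (n : ℝ) ≤ t from ht)]),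
      setLIntegral_congr_fun (s := Set.Ico 0 (n : ℝ)) (g := fun t =>
        ENNReal.ofReal (1 - f ⌊2 ^ n * s⌋₊ ⌊2 ^ n * t⌋₊)) measurableSet_Ico
        (fun t ht => by simp only [hFf s t ht.1])]
    rw [← hnn, lintegral_Ico_floor n (n * 2 ^ n) (fun l => ENNReal.ofReal (1 - f ⌊2 ^ n * s⌋₊ l)),
      lintegral_zero, add_zero, ENNReal.ofReal_sum_of_nonneg]
    · exact Finset.sum_congr rfl fun l _ => (ENNReal.ofReal_mul (by positivity)).symm
    · exact fun l _ => mul_nonneg (by positivity) (sub_nonneg.2 (h1 _ _))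
  simp_rw [hsplit, hD]
  rw [lintegral_congr fun ω => Summable.tsum_finsetSum fun k _ => ENNReal.summable,
    lintegral_finsetSum _ fun k _ => hmeas k, ← hMM]
  rw [lintegral_Ico_floor n (M * 2 ^ n) (fun k => ENNReal.ofReal (μ * Real.exp (-(μ *
    (ENNReal.ofReal (∑ l ∈ Finset.range (n * 2 ^ n), 1 / 2 ^ n * (1 - f k l))).toReal))))]
  refine Finset.sum_congr rfl fun k hk => ?_
  rw [lintegral_tsum_prodNe_cell hκ (fun l _ => hT.law n l) (hT.indep n (n * 2 ^ n)) (h0 k) (h1 k)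
    ((Finset.mem_range.1 hk).trans_le (Nat.mul_le_mul_right _ hM))
    (fun l hl => by simp [f, not_lt_of_ge hl]), ENNReal.toReal_ofReal
    (Finset.sum_nonneg fun l _ => mul_nonneg (by positivity) (sub_nonneg.2 (h1 _ _))),
    ← ENNReal.ofReal_coe_nnreal, ← ENNReal.ofReal_mul (by positivity),
    ← ENNReal.ofReal_mul (by positivity), ← mul_assoc]
  congr 2
  · push_cast
    ring
  · congr 2
    rw [Finset.mul_sum]
    refine Finset.sum_congr rfl fun l _ => ?_
    push_cast
    ring

/-- Refinement raises `dyadicLo` and lowers `dyadicHi`, and both changes lower `F`; beyond the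
cutoff the value `1` dominates. -/
lemma dyadicKernel_anti {F : ℝ → ℝ → ℝ} (hF : IsMonotoneKernel F) {s t : ℝ} (hs : 0 ≤ s)
    (ht : 0 ≤ t) : Antitone fun n => dyadicKernel F n s t := by
  intro n m hnm
  simp only [dyadicKernel]
  have hc : (n : ℝ) ≤ m := Nat.cast_le.2 hnm
  split_ifs with h1 h2 h2
  · exact hF.mono _ _ _ _ (dyadicLo_nonneg _ _) (dyadicLo_mono hs hnm) (dyadicHi_nonneg _ _)
      (dyadicHi_anti ht hnm)
  · exact hF.le_one _ _ (dyadicLo_nonneg _ _) (dyadicHi_nonneg _ _)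
  · exact absurd (h2.trans_le hc) h1
  · exact le_rfl

lemma dyadicKernel_nonneg {F : ℝ → ℝ → ℝ} (hF : IsMonotoneKernel F) (n : ℕ) (s t : ℝ) :
    0 ≤ dyadicKernel F n s t := by
  unfold dyadicKernel
  split_ifs
  exacts [hF.nonneg _ _ (dyadicLo_nonneg _ _) (dyadicHi_nonneg _ _), zero_le_one]

lemma tendsto_dyadicKernel {F : ℝ → ℝ → ℝ} (hF : IsMonotoneKernel F) {s t : ℝ} (hs : 0 ≤ s)
    (ht : 0 ≤ t) : Filter.Tendsto (fun n => dyadicKernel F n s t) Filter.atTop (nhds (F s t)) := by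
  refine (hF.tendsto s t hs ht).congr' ?_
  obtain ⟨N, hN⟩ := exists_nat_gt t
  filter_upwards [Filter.eventually_ge_atTop N] with n hn
  rw [dyadicKernel, if_pos (hN.trans_le (Nat.cast_le.2 hn))]

/-- The infinite product and the limit in `n` are both infima, so they commute. -/
lemma tendsto_prodNe_dyadicKernel {F : ℝ → ℝ → ℝ} (hF : IsMonotoneKernel F) {T : ℕ → ℝ}
    (hT : ∀ i, 0 ≤ T i) (i : ℕ) :
    Filter.Tendsto (fun n => prodNe (fun j => dyadicKernel F n (T i) (T j)) i) Filter.atTop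
      (nhds (prodNe (fun j => F (T i) (T j)) i)) := by
  have hanti : ∀ N, Antitone fun n =>
      ENNReal.ofReal (∏ j ∈ (Finset.range N).erase i, dyadicKernel F n (T i) (T j)) :=
    fun N n m hnm => ENNReal.ofReal_le_ofReal (Finset.prod_le_prod
      (fun j _ => dyadicKernel_nonneg hF _ _ _) fun j _ => dyadicKernel_anti hF (hT i) (hT j) hnm)
  have e : prodNe (fun j => F (T i) (T j)) i =
      ⨅ n, prodNe (fun j => dyadicKernel F n (T i) (T j)) i := by
    unfold prodNe
    rw [iInf_comm]
    refine iInf_congr fun N => ?_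
    refine tendsto_nhds_unique ?_ (tendsto_atTop_iInf (hanti N))
    exact ENNReal.tendsto_ofReal (tendsto_finsetProd _ fun j _ =>
      tendsto_dyadicKernel hF (hT i) (hT j))
  rw [e]
  exact tendsto_atTop_iInf fun n m hnm => iInf_mono fun N => hanti N hnm

lemma measurable_dyadicKernel {F : ℝ → ℝ → ℝ} (hF : IsMonotoneKernel F) (n : ℕ) :
    Measurable (Function.uncurry (dyadicKernel F n)) := by
  have h : Measurable fun p : ℝ × ℝ => F (dyadicLo n p.1) (dyadicHi n p.2) := by
    refine hF.measurable.comp (Measurable.prodMk ?_ ?_)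
    · exact (measurable_from_nat (f := fun k : ℕ => (k : ℝ) / 2 ^ n)).comp
        (Nat.measurable_floor.comp (measurable_fst.const_mul _))
    · exact (measurable_from_nat (f := fun k : ℕ => ((k : ℝ) + 1) / 2 ^ n)).comp
        (Nat.measurable_floor.comp (measurable_snd.const_mul _))
  exact Measurable.ite (measurableSet_lt measurable_snd measurable_const) h measurable_const

lemma tendsto_lintegral_one_sub_dyadicKernel {F : ℝ → ℝ → ℝ} (hF : IsMonotoneKernel F) {s : ℝ}
    (hs : 0 ≤ s) :
    Filter.Tendsto (fun n => ∫⁻ t in Set.Ici 0, ENNReal.ofReal (1 - dyadicKernel F n s t))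
      Filter.atTop (nhds (∫⁻ t in Set.Ici 0, ENNReal.ofReal (1 - F s t))) := by
  refine lintegral_tendsto_of_tendsto_of_monotone (fun n => ?_) ?_ ?_
  · exact (measurable_const.sub
      ((measurable_dyadicKernel hF n).comp measurable_prodMk_left)).ennreal_ofReal.aemeasurable
  · filter_upwards [ae_restrict_mem measurableSet_Ici] with t ht n m hnm
    exact ENNReal.ofReal_le_ofReal (sub_le_sub_left (dyadicKernel_anti hF hs ht hnm) _)
  · filter_upwards [ae_restrict_mem measurableSet_Ici] with t ht
    exact ENNReal.tendsto_ofReal (tendsto_const_nhds.sub (tendsto_dyadicKernel hF hs ht))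

lemma measurable_lintegral_kernel {F : ℝ → ℝ → ℝ} (hF : Measurable (Function.uncurry F)) (μ : ℝ≥0) :
    Measurable fun s => ENNReal.ofReal (μ * Real.exp (-(μ *
        (∫⁻ t in Set.Ici 0, ENNReal.ofReal (1 - F s t)).toReal))) := by
  have : Measurable fun s => ∫⁻ t in Set.Ici 0, ENNReal.ofReal (1 - F s t) :=
    Measurable.lintegral_prod_right' (f := fun p : ℝ × ℝ => ENNReal.ofReal (1 - F p.1 p.2))
      (measurable_const.sub hF).ennreal_ofReal
  exact (measurable_const.mul (measurable_const.mul this.ennreal_toReal).neg.exp).ennreal_ofReal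

lemma isMonotoneKernel_one : IsMonotoneKernel fun _ _ => 1 where
  nonneg _ _ _ _ := zero_le_one
  le_one _ _ _ _ := le_rfl
  mono _ _ _ _ _ _ _ _ := le_rfl
  measurable := measurable_const
  tendsto _ _ _ _ := tendsto_const_nhds

/-- Mecke's formula for the kernel `1` gives the mean number `μ M` of points below `M`. This
provides the dominating series below and local finiteness later. -/
lemma tsum_measure_lt_ne_top {Ω : Type*} [MeasurableSpace Ω] {P : Measure Ω} {μ : ℝ≥0}
    {T : ℕ → Ω → ℝ} (hT : IsDyadicPoisson P μ T) (M : ℕ) :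
    ∑' i, P {ω | T i ω < M} ≠ ∞ := by
  have h := lintegral_tsum_dyadicKernel hT isMonotoneKernel_one (le_refl M)
  have h1 : ∀ i, prodNe (fun _ => (1 : ℝ)) i = 1 := fun i => by simp [prodNe]
  simp only [dyadicKernel, ite_self, h1] at h
  have hmeas : ∀ i, MeasurableSet {ω | T i ω < M} := fun i =>
    measurableSet_lt (hT.measurable i) measurable_const
  rw [lintegral_tsum fun i => (Measurable.ite (hmeas i) measurable_const
    measurable_const).aemeasurable] at h
  have e : ∀ i, ∫⁻ ω, (if T i ω < M then (1 : ℝ≥0∞) else 0) ∂P = P {ω | T i ω < M} := fun i => by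
    rw [← lintegral_indicator_one (hmeas i)]; rfl
  rw [← tsum_congr e, h, setLIntegral_const]
  exact ENNReal.mul_ne_top ENNReal.ofReal_ne_top (by simp)

/-- The cutoff `T i < M` allows dominated convergence on both sides: by `P {T i < M}` on the left,
by the constant `μ` on the right. `hfin` matters because `toReal` sends `∞` to `0`, which would turn
a vanishing exponential into `1`. -/
lemma lintegral_tsum_prodNe_of_lt {Ω : Type*} [MeasurableSpace Ω] {P : Measure Ω}
    [IsProbabilityMeasure P] {μ : ℝ≥0}
    {T : ℕ → Ω → ℝ} (hT : IsDyadicPoisson P μ T) {F : ℝ → ℝ → ℝ} (hF : IsMonotoneKernel F)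
    (hfin : ∀ s, 0 ≤ s → ∫⁻ t in Set.Ici 0, ENNReal.ofReal (1 - F s t) ≠ ∞) (M : ℕ) :
    ∫⁻ ω, ∑' i, (if T i ω < M then prodNe (fun j => F (T i ω) (T j ω)) i else 0) ∂P =
      ∫⁻ s in Set.Ico (0 : ℝ) M, ENNReal.ofReal (μ * Real.exp (-(μ *
        (∫⁻ t in Set.Ici 0, ENNReal.ofReal (1 - F s t)).toReal))) := by
  have hmeas : ∀ i, MeasurableSet {ω | T i ω < M} := fun i =>
    measurableSet_lt (hT.measurable i) measurable_const
  have hm : ∀ G : ℝ → ℝ → ℝ, Measurable (Function.uncurry G) → ∀ i, Measurable fun ω =>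
      if T i ω < M then prodNe (fun j => G (T i ω) (T j ω)) i else 0 := fun G hG i =>
    Measurable.ite (hmeas i) (measurable_prodNe (fun j => hG.comp
      ((hT.measurable i).prodMk (hT.measurable j))) i) measurable_const
  have hb : ∀ G : ℝ → ℝ → ℝ, ∀ i ω, (if T i ω < M then prodNe (fun j => G (T i ω) (T j ω)) i else 0) ≤
      if T i ω < M then 1 else 0 := fun G i ω => by
    split_ifs; exacts [prodNe_le_one _ _, le_rfl]
  have hi : ∀ i, ∫⁻ ω, (if T i ω < M then (1 : ℝ≥0∞) else 0) ∂P = P {ω | T i ω < M} := fun i => by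
    rw [← lintegral_indicator_one (hmeas i)]; rfl
  have hleft : Filter.Tendsto (fun n => ∫⁻ ω, ∑' i, (if T i ω < M then
      prodNe (fun j => dyadicKernel F n (T i ω) (T j ω)) i else 0) ∂P) Filter.atTop
      (nhds (∫⁻ ω, ∑' i, (if T i ω < M then prodNe (fun j => F (T i ω) (T j ω)) i else 0) ∂P)) := by
    simp_rw [fun n => lintegral_tsum (μ := P) fun i =>
      (hm _ (measurable_dyadicKernel hF n) i).aemeasurable]
    rw [lintegral_tsum fun i => (hm _ hF.measurable i).aemeasurable]
    -- Dominated convergence is used twice: for the counting measure on indices, and inside it for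
    -- `P` at each index.
    simp_rw [← lintegral_count]
    refine tendsto_lintegral_of_dominated_convergence (fun i => P {ω | T i ω < M})
      (fun n => measurable_from_nat) (fun n => .of_forall fun i => ?_) ?_ (.of_forall fun i => ?_)
    · refine le_of_le_of_eq ?_ (hi i)
      exact lintegral_mono (hb _ i)
    · rw [lintegral_count]
      exact tsum_measure_lt_ne_top hT M
    · refine tendsto_lintegral_of_dominated_convergence (fun ω => if T i ω < M then 1 else 0)
        (fun n => hm _ (measurable_dyadicKernel hF n) i) (fun n => .of_forall (hb _ i)) ?_
        (.of_forall fun ω => ?_)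
      · rw [hi]; exact measure_ne_top _ _
      · split_ifs
        · exact tendsto_prodNe_dyadicKernel hF (fun j => hT.nonneg j ω) i
        · exact tendsto_const_nhds
  have hright : Filter.Tendsto (fun n => ∫⁻ s in Set.Ico (0 : ℝ) M, ENNReal.ofReal (μ * Real.exp (-(μ *
        (∫⁻ t in Set.Ici 0, ENNReal.ofReal (1 - dyadicKernel F n s t)).toReal)))) Filter.atTop
      (nhds (∫⁻ s in Set.Ico (0 : ℝ) M, ENNReal.ofReal (μ * Real.exp (-(μ *
        (∫⁻ t in Set.Ici 0, ENNReal.ofReal (1 - F s t)).toReal))))) := by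
    refine tendsto_lintegral_of_dominated_convergence (fun _ => μ)
      (fun n => measurable_lintegral_kernel (measurable_dyadicKernel hF n) μ)
      (fun n => .of_forall fun s => ?_) ?_ ?_
    · rw [← ENNReal.ofReal_coe_nnreal]
      refine ENNReal.ofReal_le_ofReal (mul_le_of_le_one_right (by positivity) ?_)
      exact Real.exp_le_one_iff.2 (neg_nonpos.2 (by positivity))
    · rw [setLIntegral_const]
      exact ENNReal.mul_ne_top ENNReal.coe_ne_top (by simp)
    · filter_upwards [ae_restrict_mem measurableSet_Ico] with s hs
      refine ENNReal.tendsto_ofReal (tendsto_const_nhds.mul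
        ((Real.continuous_exp.tendsto _).comp (tendsto_const_nhds.mul ?_).neg))
      exact (ENNReal.tendsto_toReal (hfin s hs.1)).comp
        (tendsto_lintegral_one_sub_dyadicKernel hF hs.1)
  refine tendsto_nhds_unique hleft (hright.congr' ?_)
  filter_upwards [Filter.eventually_ge_atTop M] with n hn
  exact (lintegral_tsum_dyadicKernel hT hF hn).symm

/-- Mecke's formula for a Poisson process on the half-line and a product functional. -/
theorem lintegral_tsum_prodNe {Ω : Type*} [MeasurableSpace Ω] {P : Measure Ω}
    [IsProbabilityMeasure P] {μ : ℝ≥0}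
    {T : ℕ → Ω → ℝ} (hT : IsDyadicPoisson P μ T) {F : ℝ → ℝ → ℝ} (hF : IsMonotoneKernel F)
    (hfin : ∀ s, 0 ≤ s → ∫⁻ t in Set.Ici 0, ENNReal.ofReal (1 - F s t) ≠ ∞) :
    ∫⁻ ω, ∑' i, prodNe (fun j => F (T i ω) (T j ω)) i ∂P =
      ∫⁻ s in Set.Ici (0 : ℝ), ENNReal.ofReal (μ * Real.exp (-(μ *
        (∫⁻ t in Set.Ici 0, ENNReal.ofReal (1 - F s t)).toReal))) := by
  have hmono : ∀ i ω, Monotone fun M : ℕ =>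
      if T i ω < M then prodNe (fun j => F (T i ω) (T j ω)) i else 0 := by
    intro i ω M M' hMM
    have : (M : ℝ) ≤ M' := Nat.cast_le.2 hMM
    simp only
    split_ifs with h1 h2
    · exact le_rfl
    · exact absurd (h1.trans_le this) h2
    · exact zero_le
    · exact zero_le
  have hleft : Filter.Tendsto (fun M : ℕ => ∫⁻ ω, ∑' i, (if T i ω < M then
      prodNe (fun j => F (T i ω) (T j ω)) i else 0) ∂P) Filter.atTop
      (nhds (∫⁻ ω, ∑' i, prodNe (fun j => F (T i ω) (T j ω)) i ∂P)) := by
    refine lintegral_tendsto_of_tendsto_of_monotone (fun M => ?_) (.of_forall fun ω M M' hMM => ?_)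
      (.of_forall fun ω => ?_)
    · refine (Measurable.tsum fun i => Measurable.ite
        (measurableSet_lt (hT.measurable i) measurable_const) (measurable_prodNe (fun j =>
          hF.measurable.comp ((hT.measurable i).prodMk (hT.measurable j))) i)
        measurable_const).aemeasurable
    · exact ENNReal.tsum_le_tsum fun i => hmono i ω hMM
    · simp_rw [← lintegral_count]
      refine lintegral_tendsto_of_tendsto_of_monotone (fun M => measurable_from_nat.aemeasurable)
        (.of_forall fun i => hmono i ω) (.of_forall fun i => ?_)
      obtain ⟨N, hN⟩ := exists_nat_gt (T i ω)
      refine tendsto_const_nhds.congr' ?_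
      filter_upwards [Filter.eventually_ge_atTop N] with M hM
      rw [if_pos (hN.trans_le (Nat.cast_le.2 hM))]
  have hright : Filter.Tendsto (fun M : ℕ => ∫⁻ s in Set.Ico (0 : ℝ) M, ENNReal.ofReal (μ *
      Real.exp (-(μ * (∫⁻ t in Set.Ici 0, ENNReal.ofReal (1 - F s t)).toReal)))) Filter.atTop
      (nhds (∫⁻ s in Set.Ici (0 : ℝ), ENNReal.ofReal (μ * Real.exp (-(μ *
        (∫⁻ t in Set.Ici 0, ENNReal.ofReal (1 - F s t)).toReal))))) := by
    have hU : Set.Ici (0 : ℝ) = ⋃ M : ℕ, Set.Ico (0 : ℝ) M := by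
      ext s
      simp only [Set.mem_Ici, Set.mem_iUnion, Set.mem_Ico, exists_and_left]
      exact ⟨fun h => ⟨h, exists_nat_gt s⟩, fun h => h.1⟩
    have hmonoI : Monotone fun M : ℕ => Set.Ico (0 : ℝ) M :=
      fun M M' h => Set.Ico_subset_Ico_right (Nat.cast_le.2 h)
    rw [hU, setLIntegral_iUnion_of_directed _ hmonoI.directed_le]
    exact tendsto_atTop_iSup fun M M' h => lintegral_mono_set (hmonoI h)
  refine tendsto_nhds_unique hleft (hright.congr fun M => ?_)
  exact (lintegral_tsum_prodNe_of_lt hT hF hfin M).symm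

/-! ### Rayleigh fading -/

/-- The function `y ↦ exp (-y)` on `[0, ∞]`. -/
def expNeg (y : ℝ≥0∞) : ℝ≥0∞ := EReal.exp (-(y : EReal))

/-- Continuity at `∞` is included: partial sums of the interference have to pass to the limit before
it is known to be finite. -/
lemma continuous_expNeg : Continuous expNeg :=
  ENNReal.continuous_exp.comp (continuous_neg.comp continuous_coe_ennreal_ereal)

lemma expNeg_ofReal {y : ℝ} (hy : 0 ≤ y) : expNeg (ENNReal.ofReal y) = ENNReal.ofReal (Real.exp (-y)) := by
  rw [expNeg, EReal.coe_ennreal_ofReal, max_eq_left hy, ← EReal.coe_neg, EReal.exp_coe]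

lemma expNeg_top : expNeg ∞ = 0 := by simp [expNeg]

lemma expNeg_le_one (y : ℝ≥0∞) : expNeg y ≤ 1 := by
  simpa [expNeg] using EReal.coe_ennreal_nonneg y

lemma expNeg_sum {ι : Type*} (s : Finset ι) (y : ι → ℝ≥0∞) :
    expNeg (∑ j ∈ s, y j) = ∏ j ∈ s, expNeg (y j) := by
  classical
  induction s using Finset.induction_on with
  | empty => simp [expNeg]
  | insert a s ha ih =>
    rw [Finset.sum_insert ha, Finset.prod_insert ha, ← ih]
    simp only [expNeg]
    rw [← EReal.exp_add, EReal.coe_ennreal_add, EReal.neg_add, sub_eq_add_neg]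
    · exact Or.inl (EReal.coe_ennreal_ne_bot _)
    · exact Or.inr (EReal.coe_ennreal_ne_bot _)

lemma expMeasure_setOf_lt_ofReal (y : ℝ≥0∞) :
    expMeasure 1 {z | y < ENNReal.ofReal z} = expNeg y := by
  have := isProbabilityMeasure_expMeasure zero_lt_one
  induction y using ENNReal.recTopCoe with
  | top => simp [expNeg_top]
  | coe y =>
    have e : {z : ℝ | (y : ℝ≥0∞) < ENNReal.ofReal z} = (Set.Iic (y : ℝ))ᶜ := by
      ext z
      simp only [Set.mem_ofPred_eq, Set.mem_compl_iff, Set.mem_Iic, not_le]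
      rw [← ENNReal.ofReal_coe_nnreal, ENNReal.ofReal_lt_ofReal_iff']
      exact ⟨fun h => h.1, fun h => ⟨h, y.2.trans_lt h⟩⟩
    rw [e, prob_compl_eq_one_sub measurableSet_Iic, ← ofReal_cdf, cdf_expMeasure_eq zero_lt_one,
      if_pos (NNReal.coe_nonneg y), ← ENNReal.ofReal_one, ← ENNReal.ofReal_sub]
    · rw [← ENNReal.ofReal_coe_nnreal, expNeg_ofReal (NNReal.coe_nonneg y)]
      simp
    · simp

/-- Tilting the unit exponential density by `exp(-c z)` gives `1 / (1 + c)` times the exponential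
density of rate `1 + c`. -/
lemma lintegral_expNeg_expMeasure {c : ℝ} (hc : 0 ≤ c) :
    ∫⁻ z, expNeg (ENNReal.ofReal (z * c)) ∂(expMeasure 1) = ENNReal.ofReal (1 / (1 + c)) := by
  have hm : Measurable fun z : ℝ => expNeg (ENNReal.ofReal (z * c)) :=
    continuous_expNeg.measurable.comp (measurable_id.mul_const c).ennreal_ofReal
  have hp : ∀ r, Measurable (exponentialPDF r) := fun r =>
    (measurable_exponentialPDFReal r).ennreal_ofReal
  rw [expMeasure, gammaMeasure]
  change ∫⁻ z, _ ∂(volume.withDensity (exponentialPDF 1)) = _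
  rw [lintegral_withDensity_eq_lintegral_mul _ (hp 1) hm]
  have e : ∀ z, (exponentialPDF 1 * fun z => expNeg (ENNReal.ofReal (z * c))) z =
      ENNReal.ofReal (1 / (1 + c)) * exponentialPDF (1 + c) z := by
    intro z
    rw [Pi.mul_apply]
    by_cases hz : 0 ≤ z
    · rw [exponentialPDF_of_nonneg hz, exponentialPDF_of_nonneg hz, expNeg_ofReal (by positivity),
        ← ENNReal.ofReal_mul (by positivity), ← ENNReal.ofReal_mul (by positivity)]
      congr 1
      rw [one_mul, ← Real.exp_add, ← mul_assoc, one_div, inv_mul_cancel₀ (by positivity), one_mul]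
      ring_nf
    · rw [exponentialPDF_of_neg (not_le.1 hz), exponentialPDF_of_neg (not_le.1 hz)]
      simp
  rw [lintegral_congr e, lintegral_const_mul _ (hp _), lintegral_exponentialPDF_eq_one (by linarith),
    mul_one]

lemma tendsto_sum_erase_tsum_ne (a : ℕ → ℝ≥0∞) (i : ℕ) :
    Filter.Tendsto (fun N => ∑ j ∈ (Finset.range N).erase i, a j) Filter.atTop
      (nhds (∑' j : {j // j ≠ i}, a j)) := by
  have h := ENNReal.tendsto_nat_tsum ({j | j ≠ i}.indicator a)
  rw [← tsum_subtype] at h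
  refine h.congr fun N => ?_
  rw [Finset.sum_indicator_eq_sum_filter]
  refine Finset.sum_congr ?_ fun _ _ => rfl
  ext j
  simp [and_comm]

/-- Conditioning on the interference `Y`, independent of `g i`, replaces the event by the
exponential tail `expNeg Y`; the mean of this is a limit of products of Laplace transforms. -/
lemma measure_tsum_lt_eq_prodNe {Ω : Type*} [MeasurableSpace Ω] {P : Measure Ω}
    [IsProbabilityMeasure P] {g : ℕ → Ω → ℝ} (hm : ∀ i, Measurable (g i))
    (hlaw : ∀ i, HasLaw (g i) (expMeasure 1) P) (hind : iIndepFun g P) {c : ℕ → ℝ}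
    (hc : ∀ j, 0 ≤ c j) (i : ℕ) :
    P {ω | ∑' j : {j // j ≠ i}, ENNReal.ofReal (g j ω * c j) < ENNReal.ofReal (g i ω)} =
      prodNe (fun j => 1 / (1 + c j)) i := by
  have := isProbabilityMeasure_expMeasure zero_lt_one
  set Y : Ω → ℝ≥0∞ := fun ω => ∑' j : {j // j ≠ i}, ENNReal.ofReal (g j ω * c j) with hY
  have hYm : Measurable Y := .tsum fun j => ((hm j).mul_const _).ennreal_ofReal
  have hgY : IndepFun (g i) Y P := by
    have h : IndepFun (g i) (fun ω (j : {j // j ≠ i}) => g j ω) P := by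
      refine IndepFun.indepFun_process (hm i) (fun j => hm j) fun I => ?_
      have hd : Disjoint {i} (I.map (Function.Embedding.subtype (· ≠ i))) := by simp
      have := hind.indepFun_finset _ _ hd hm
      have h1 : Measurable fun f : ({i} : Finset ℕ) → ℝ => f ⟨i, by simp⟩ := measurable_pi_apply _
      have h2 : Measurable fun (f : I.map (Function.Embedding.subtype (· ≠ i)) → ℝ) (j : I) =>
          f ⟨j.1, Finset.mem_map_of_mem _ j.2⟩ := measurable_pi_lambda _ fun j => measurable_pi_apply _
      exact this.comp h1 h2
    exact h.comp (φ := id) (ψ := fun f => ∑' j : {j // j ≠ i}, ENNReal.ofReal (f j * c j))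
      measurable_id (.tsum fun j => ((measurable_pi_apply j).mul_const _).ennreal_ofReal)
  have hS : MeasurableSet {p : ℝ≥0∞ × ℝ | p.1 < ENNReal.ofReal p.2} :=
    measurableSet_lt measurable_fst measurable_snd.ennreal_ofReal
  have h1 : P {ω | Y ω < ENNReal.ofReal (g i ω)} = ∫⁻ ω, expNeg (Y ω) ∂P := by
    have := (indepFun_iff_map_prod_eq_prod_map_map hYm.aemeasurable (hm i).aemeasurable).1 hgY.symm
    change P ((fun ω => (Y ω, g i ω)) ⁻¹' {p : ℝ≥0∞ × ℝ | p.1 < ENNReal.ofReal p.2}) = _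
    rw [← Measure.map_apply (hYm.prodMk (hm i)) hS, this, (hlaw i).map_eq,
      Measure.prod_apply hS, lintegral_map (measurable_measure_prodMk_left hS) hYm]
    exact lintegral_congr fun ω => expMeasure_setOf_lt_ofReal (Y ω)
  have hYN : ∀ N, Measurable fun ω => expNeg (∑ j ∈ (Finset.range N).erase i,
      ENNReal.ofReal (g j ω * c j)) := fun N => continuous_expNeg.measurable.comp
    (Finset.measurable_fun_sum _ fun j _ => ((hm j).mul_const _).ennreal_ofReal)
  have h2 : Filter.Tendsto (fun N => ∫⁻ ω, expNeg (∑ j ∈ (Finset.range N).erase i,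
      ENNReal.ofReal (g j ω * c j)) ∂P) Filter.atTop (nhds (∫⁻ ω, expNeg (Y ω) ∂P)) := by
    refine tendsto_lintegral_of_dominated_convergence (fun _ => 1) hYN
      (fun N => .of_forall fun ω => expNeg_le_one _) (by simp) (.of_forall fun ω => ?_)
    exact (continuous_expNeg.tendsto _).comp (tendsto_sum_erase_tsum_ne (fun j => ENNReal.ofReal (g j ω * c j)) i)
  have h3 : ∀ N, ∫⁻ ω, expNeg (∑ j ∈ (Finset.range N).erase i, ENNReal.ofReal (g j ω * c j)) ∂P =
      ENNReal.ofReal (∏ j ∈ (Finset.range N).erase i, 1 / (1 + c j)) := by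
    intro N
    have hφ : ∀ j, Measurable fun z : ℝ => expNeg (ENNReal.ofReal (z * c j)) := fun j =>
      continuous_expNeg.measurable.comp (measurable_id.mul_const _).ennreal_ofReal
    rw [lintegral_congr fun ω => expNeg_sum _ _, lintegral_prod_eq_prod_lintegral_of_indepFun _
      (fun j ω => expNeg (ENNReal.ofReal (g j ω * c j)))
      (hind.comp (fun j z => expNeg (ENNReal.ofReal (z * c j))) hφ) fun j => (hφ j).comp (hm j),
      ENNReal.ofReal_prod_of_nonneg fun j _ => div_nonneg zero_le_one (add_nonneg zero_le_one (hc j))]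
    refine Finset.prod_congr rfl fun j _ => ?_
    rw [(hlaw j).lintegral_comp (hφ j).aemeasurable, lintegral_expNeg_expMeasure (hc j)]
  rw [h1]
  refine tendsto_nhds_unique h2 ?_
  simp_rw [h3]
  refine tendsto_atTop_iInf fun N N' h => ENNReal.ofReal_le_ofReal ?_
  have h01 : ∀ j, 0 ≤ 1 / (1 + c j) ∧ 1 / (1 + c j) ≤ 1 := fun j => by
    have := hc j
    exact ⟨by positivity, (div_le_one (by positivity)).2 (by linarith)⟩
  exact Finset.prod_le_prod_of_subset_of_le_one
    (Finset.erase_subset_erase _ (Finset.range_subset_range.2 h)) (fun j _ => (h01 j).1)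
    fun j _ _ => (h01 j).2

lemma ofReal_lt_sir_iff {a : ℕ → ℝ} {ℓ : ℕ → ℝ} (hℓ : ∀ j, 0 < ℓ j) {θ : ℝ} (hθ : 0 < θ) (i : ℕ) :
    ENNReal.ofReal θ < ENNReal.ofReal (a i * ℓ i) /
        ∑' j : {j : ℕ // j ≠ i}, ENNReal.ofReal (a j * ℓ j) ↔
      ∑' j : {j // j ≠ i}, ENNReal.ofReal (a j * (θ * ℓ j / ℓ i)) < ENNReal.ofReal (a i) := by
  have hθ' : ENNReal.ofReal θ ≠ 0 := by simpa using hθ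
  -- Since the threshold is neither `0` nor `∞`, the equivalence survives an interference equal to
  -- `0` or `∞`.
  rw [ENNReal.lt_div_iff_mul_lt (Or.inr ENNReal.ofReal_ne_top) (Or.inr hθ'),
    ENNReal.ofReal_mul' (hℓ i).le, ← ENNReal.div_lt_iff (Or.inl (by simpa using hℓ i))
    (Or.inl ENNReal.ofReal_ne_top), ← ENNReal.tsum_mul_left, div_eq_mul_inv,
    ← ENNReal.tsum_mul_right]
  have : ∀ j, ENNReal.ofReal θ * ENNReal.ofReal (a j * ℓ j) * (ENNReal.ofReal (ℓ i))⁻¹ =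
      ENNReal.ofReal (a j * (θ * ℓ j / ℓ i)) := by
    intro j
    rw [← ENNReal.ofReal_inv_of_pos (hℓ i), ← ENNReal.ofReal_mul hθ.le,
      ← ENNReal.ofReal_mul' (inv_nonneg.2 (hℓ i).le)]
    congr 1
    ring
  simp_rw [this]

/-! ### The hypergeometric function as an interference integral -/

/-- Both sides are the Pochhammer symbol of order `n + 1`. For `a = -(1 / β)` the ratio of the two
symbols in the series collapses to `-(1 / (β n - 1))`. -/
lemma ascPochhammer_eval_mul_add (a : ℝ) (n : ℕ) :
    (ascPochhammer ℝ n).eval a * (a + n) = a * (ascPochhammer ℝ n).eval (a + 1) := by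
  rw [← ascPochhammer_succ_eval, ascPochhammer_succ_left]
  simp

lemma integrableOn_inv_rpow {β : ℝ} (hβ : 1 < β) :
    IntegrableOn (fun u : ℝ => (u ^ β)⁻¹) (Set.Ioi 1) :=
  (integrableOn_Ioi_rpow_of_lt (a := -β) (by linarith) zero_lt_one).congr_fun
    (fun u hu => Real.rpow_neg (zero_le_one.trans (le_of_lt hu)) β) measurableSet_Ioi

lemma integrableOn_div_add_rpow {β : ℝ} (hβ : 1 < β) {s : ℝ} (hs : 0 ≤ s) :
    IntegrableOn (fun u : ℝ => s / (s + u ^ β)) (Set.Ioi 1) := by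
  refine ((integrableOn_inv_rpow hβ).const_mul s).mono'
    (Measurable.aestronglyMeasurable (by fun_prop)) ?_
  filter_upwards [ae_restrict_mem measurableSet_Ioi] with u hu
  have hu0 : 0 < u ^ β := Real.rpow_pos_of_pos (zero_lt_one.trans hu) β
  rw [Real.norm_of_nonneg (by positivity), ← div_eq_mul_inv]
  gcongr
  linarith

lemma integral_inv_rpow_pow {β : ℝ} (hβ : 1 < β) (n : ℕ) :
    IntegrableOn (fun u : ℝ => (u ^ β)⁻¹ ^ (n + 1)) (Set.Ioi 1) ∧
    ∫ u in Set.Ioi (1 : ℝ), (u ^ β)⁻¹ ^ (n + 1) = 1 / (β * (n + 1) - 1) := by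
  have h1 : -(β * (n + 1)) < -1 := by
    have : (0 : ℝ) ≤ n := by positivity
    nlinarith
  have e : Set.EqOn (fun u : ℝ => u ^ (-(β * (n + 1)))) (fun u : ℝ => (u ^ β)⁻¹ ^ (n + 1))
      (Set.Ioi 1) := by
    intro u hu
    have hu0 : 0 ≤ u := zero_le_one.trans (le_of_lt hu)
    simp only
    rw [Real.rpow_neg hu0, Real.rpow_mul hu0, inv_pow, ← Real.rpow_natCast]
    push_cast
    rfl
  refine ⟨(integrableOn_Ioi_rpow_of_lt h1 zero_lt_one).congr_fun e measurableSet_Ioi, ?_⟩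
  rw [← setIntegral_congr_fun measurableSet_Ioi e, integral_Ioi_rpow_of_lt h1 zero_lt_one,
    Real.one_rpow, neg_div, ← div_neg]
  congr 1
  ring

/-- Geometric expansion of the integrand with ratio `-s u^(-β)`, integrated termwise. -/
lemma hasSum_integral_of_lt_one {β : ℝ} (hβ : 1 < β) {s : ℝ} (hs : 0 ≤ s) (hs1 : s < 1) :
    HasSum (fun n : ℕ => (-1) ^ n * s ^ (n + 1) * (1 / (β * (n + 1) - 1)))
      (∫ u in Set.Ioi (1 : ℝ), s / (s + u ^ β)) := by
  have hd : ∀ n : ℕ, β - 1 ≤ β * (n + 1) - 1 := fun n => by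
    have : (0 : ℝ) ≤ n := by positivity
    nlinarith
  have h := hasSum_integral_of_summable_integral_norm (μ := volume.restrict (Set.Ioi (1 : ℝ)))
    (F := fun (n : ℕ) u => (-1) ^ n * s ^ (n + 1) * (u ^ β)⁻¹ ^ (n + 1))
    (fun n => (integral_inv_rpow_pow hβ n).1.const_mul _) ?_
  · simp only [integral_const_mul, (integral_inv_rpow_pow hβ _).2] at h
    convert! h using 1
    refine setIntegral_congr_fun measurableSet_Ioi fun u hu => ?_
    have hu1 : 1 < u ^ β := Real.one_lt_rpow hu (by linarith)
    have hq : |-(s * (u ^ β)⁻¹)| < 1 := by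
      rw [abs_neg, abs_of_nonneg (by positivity), ← div_eq_mul_inv, div_lt_one (by linarith)]
      linarith
    have := (hasSum_geometric_of_abs_lt_one hq).mul_left (s * (u ^ β)⁻¹)
    rw [tsum_congr (g := fun n => s * (u ^ β)⁻¹ * (-(s * (u ^ β)⁻¹)) ^ n), this.tsum_eq]
    · have : 1 + s * (u ^ β)⁻¹ ≠ 0 := by positivity
      simp only [sub_neg_eq_add]
      field_simp
      rw [add_comm]
    · intro n
      rw [neg_pow (s * _), mul_pow]
      ring
  · have e : ∀ n : ℕ, ∫ u in Set.Ioi (1 : ℝ), ‖(-1) ^ n * s ^ (n + 1) * (u ^ β)⁻¹ ^ (n + 1)‖ =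
        s ^ (n + 1) * (1 / (β * (n + 1) - 1)) := by
      intro n
      rw [← (integral_inv_rpow_pow hβ n).2, ← integral_const_mul]
      refine setIntegral_congr_fun measurableSet_Ioi fun u hu => ?_
      have hu0 : 0 < u ^ β := Real.rpow_pos_of_pos (zero_lt_one.trans hu) β
      simp only [norm_mul, norm_pow, norm_neg, norm_one, one_pow, one_mul, norm_inv]
      rw [Real.norm_of_nonneg hs, Real.norm_of_nonneg hu0.le]
    simp_rw [e]
    refine Summable.of_nonneg_of_le (fun n => ?_) (fun n => ?_)
      (((summable_nat_add_iff 1).2 (summable_geometric_of_lt_one hs hs1)).mul_right (1 / (β - 1)))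
    · have : 0 < β * (n + 1) - 1 := lt_of_lt_of_le (by linarith) (hd n)
      positivity
    · have : 0 < β - 1 := by linarith
      gcongr
      linarith [hd n]

lemma gaussHypergeometric_of_lt_one {β : ℝ} (hβ : 1 < β) {s : ℝ} (hs : 0 ≤ s) (hs1 : s < 1) :
    gaussHypergeometric 1 (-(1 / β)) (1 - 1 / β) (-s) =
      1 + ∫ u in Set.Ioi (1 : ℝ), s / (s + u ^ β) := by
  have hβ0 : 0 < β := by linarith
  have hδ : 1 / β < 1 := (div_lt_one hβ0).2 hβ
  rw [gaussHypergeometric, if_pos (by rwa [abs_neg, abs_of_nonneg hs]),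
    ordinaryHypergeometric_eq_tsum]
  refine HasSum.tsum_eq ((hasSum_nat_add_iff' 1).1 ?_)
  simp only [Finset.range_one, Finset.sum_singleton, Nat.factorial_zero, Nat.cast_one, inv_one,
    ascPochhammer_zero, Polynomial.eval_one, mul_one, pow_zero, smul_eq_mul, add_sub_cancel_left]
  convert! hasSum_integral_of_lt_one hβ hs hs1 using 2 with n
  have hp : 0 < (ascPochhammer ℝ (n + 1)).eval (1 - 1 / β) := ascPochhammer_pos _ _ (by linarith)
  have h := ascPochhammer_eval_mul_add (-(1 / β)) (n + 1)
  rw [show -(1 / β) + 1 = 1 - 1 / β by ring] at h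
  have hn : 0 < β * (n + 1) - 1 := by
    have : (0 : ℝ) ≤ n := by positivity
    nlinarith
  have h' : (ascPochhammer ℝ (n + 1)).eval (-(1 / β)) * ((ascPochhammer ℝ (n + 1)).eval (1 - 1 / β))⁻¹ =
      -(1 / (β * (n + 1) - 1)) := by
    rw [← div_eq_mul_inv, div_eq_iff hp.ne']
    push_cast at h
    field_simp at h ⊢
    linarith
  rw [ascPochhammer_eval_one, inv_mul_cancel₀ (by positivity), one_mul, h', neg_pow]
  ring

lemma integrableOn_beta {β : ℝ} (hβ : 1 < β) (n : ℕ) :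
    IntegrableOn (fun u : ℝ => (u ^ β)⁻¹ * (1 - (u ^ β)⁻¹) ^ n) (Set.Ioi 1) := by
  refine (integrableOn_inv_rpow hβ).mono' (by fun_prop) ?_
  filter_upwards [ae_restrict_mem measurableSet_Ioi] with u hu
  have hu1 : 1 < u ^ β := Real.one_lt_rpow hu (by linarith)
  have h0 : 0 ≤ 1 - (u ^ β)⁻¹ := sub_nonneg.2 (inv_le_one_of_one_le₀ hu1.le)
  rw [Real.norm_of_nonneg (by positivity)]
  refine mul_le_of_le_one_right (by positivity) (pow_le_one₀ h0 ?_)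
  have : 0 < (u ^ β)⁻¹ := by positivity
  linarith

/-- Integrate the derivative of `u (1 - (1 - u^(-β))^(n+1))`, which is `1` at `u = 1` and tends to
`0` at infinity by Bernoulli's inequality. -/
lemma sum_beta_integral_recurrence {β : ℝ} (hβ : 1 < β) (n : ℕ) :
    1 + ∑ k ∈ Finset.range (n + 1), ∫ u in Set.Ioi (1 : ℝ), (u ^ β)⁻¹ * (1 - (u ^ β)⁻¹) ^ k =
      β * (n + 1) * ∫ u in Set.Ioi (1 : ℝ), (u ^ β)⁻¹ * (1 - (u ^ β)⁻¹) ^ n := by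
  have hderiv : ∀ u ∈ Set.Ici (1 : ℝ), HasDerivAt (fun u : ℝ => u * (1 - (1 - u ^ (-β)) ^ (n + 1)))
      (∑ k ∈ Finset.range (n + 1), (u ^ β)⁻¹ * (1 - (u ^ β)⁻¹) ^ k -
        β * (n + 1) * ((u ^ β)⁻¹ * (1 - (u ^ β)⁻¹) ^ n)) u := by
    intro u hu
    have hu0 : 0 < u := zero_lt_one.trans_le hu
    have h1 := (((Real.hasDerivAt_rpow_const (p := -β) (Or.inl hu0.ne')).const_sub 1).pow
      (n + 1)).const_sub 1
    convert! (hasDerivAt_id' u).mul h1 using 1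
    simp only [Pi.pow_apply, Nat.add_sub_cancel]
    rw [Real.rpow_sub_one hu0.ne', Real.rpow_neg hu0.le, ← Finset.mul_sum]
    have hg := mul_neg_geom_sum (1 - (u ^ β)⁻¹) (n + 1)
    rw [sub_sub_cancel] at hg
    rw [hg]
    generalize (u ^ β)⁻¹ = v
    push_cast
    field_simp
    ring
  have hlim : Filter.Tendsto (fun u : ℝ => u * (1 - (1 - u ^ (-β)) ^ (n + 1))) Filter.atTop
      (nhds 0) := by
    have h := (tendsto_rpow_neg_atTop (y := β - 1) (by linarith)).const_mul ((n : ℝ) + 1)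
    rw [mul_zero] at h
    refine tendsto_of_tendsto_of_tendsto_of_le_of_le' tendsto_const_nhds h ?_ ?_
    · filter_upwards [Filter.eventually_ge_atTop 1] with u hu
      have hv : 0 ≤ u ^ (-β) := Real.rpow_nonneg (by linarith) _
      have hv1 : u ^ (-β) ≤ 1 := Real.rpow_le_one_of_one_le_of_nonpos hu (by linarith)
      exact mul_nonneg (by linarith) (sub_nonneg.2 (pow_le_one₀ (by linarith) (by linarith)))
    · filter_upwards [Filter.eventually_ge_atTop 1] with u hu
      have hu0 : 0 < u := by linarith
      have hv : 0 ≤ u ^ (-β) := Real.rpow_nonneg (by linarith) _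
      have hv1 : u ^ (-β) ≤ 1 := Real.rpow_le_one_of_one_le_of_nonpos hu (by linarith)
      have hb := one_add_mul_le_pow (a := -u ^ (-β)) (by linarith) (n + 1)
      rw [← sub_eq_add_neg] at hb
      push_cast at hb
      rw [show -(β - 1) = -β + 1 by ring, Real.rpow_add_one hu0.ne']
      nlinarith
  have hint : ∀ k, Integrable (fun u : ℝ => (u ^ β)⁻¹ * (1 - (u ^ β)⁻¹) ^ k)
    (volume.restrict (Set.Ioi 1)) := integrableOn_beta hβ
  have hF := integral_Ioi_of_hasDerivAt_of_tendsto' hderiv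
    ((integrable_finsetSum _ fun k _ => hint k).sub ((hint n).const_mul _)) hlim
  rw [integral_sub (integrable_finsetSum _ fun k _ => hint k) ((hint n).const_mul _),
    integral_const_mul, integral_finsetSum _ fun k _ => hint k] at hF
  simp only [Real.one_rpow, sub_self, ne_eq, Nat.add_eq_zero_iff, one_ne_zero, and_false,
    not_false_eq_true, zero_pow, sub_zero, mul_one, zero_sub] at hF
  linarith

/-- These are the series coefficients after the Pfaff transformation. By the recurrence both sides
get multiplied by `(n + 1) β / (β (n + 1) - 1)` from `n` to `n + 1`. -/
lemma factorial_div_ascPochhammer_eq {β : ℝ} (hβ : 1 < β) (n : ℕ) :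
    n.factorial * ((ascPochhammer ℝ n).eval (1 - 1 / β))⁻¹ =
      1 + ∑ k ∈ Finset.range n, ∫ u in Set.Ioi (1 : ℝ), (u ^ β)⁻¹ * (1 - (u ^ β)⁻¹) ^ k := by
  induction n with
  | zero => simp
  | succ n ih =>
    have hβ0 : 0 < β := by linarith
    have hr := sum_beta_integral_recurrence hβ n
    have hn : 0 < β * (n + 1) - 1 := by
      have : (0 : ℝ) ≤ n := by positivity
      nlinarith
    have hc : 1 - 1 / β + n = (β * (n + 1) - 1) / β := by field_simp; ring
    rw [Finset.sum_range_succ, ← add_assoc, ← ih] at hr ⊢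
    rw [ascPochhammer_succ_eval, Nat.factorial_succ, mul_inv, hc]
    push_cast
    set A := (n.factorial : ℝ) * ((ascPochhammer ℝ n).eval (1 - 1 / β))⁻¹
    set B := ∫ u in Set.Ioi (1 : ℝ), (u ^ β)⁻¹ * (1 - (u ^ β)⁻¹) ^ n
    have e : ((n : ℝ) + 1) * n.factorial * (((ascPochhammer ℝ n).eval (1 - 1 / β))⁻¹ *
        ((β * (n + 1) - 1) / β)⁻¹) = (n + 1) * β / (β * (n + 1) - 1) * A := by
      rw [inv_div]
      simp only [A]
      ring
    have hB : B = A / (β * (n + 1) - 1) := by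
      rw [eq_div_iff hn.ne']
      linarith
    rw [e, hB, div_mul_eq_mul_div, div_eq_iff hn.ne', add_mul A, div_mul_cancel₀ _ hn.ne']
    ring

/-- With `v = u^(-β)` and the Pfaff argument `w = s / (1 + s)`, the integrand is `w v / (1 - w (1 -
v))`, a geometric series convergent for every `s`. Multiplying the transformed series by its
prefactor `1 - w` telescopes its coefficients `A n` to the same terms, as `A (n + 1) - A n = B n`.
-/
lemma gaussHypergeometric_of_one_le {β : ℝ} (hβ : 1 < β) {s : ℝ} (hs : 1 ≤ s) :
    gaussHypergeometric 1 (-(1 / β)) (1 - 1 / β) (-s) =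
      1 + ∫ u in Set.Ioi (1 : ℝ), s / (s + u ^ β) := by
  have hs0 : 0 < s := by linarith
  set w := s / (1 + s) with hw
  have hw0 : 0 ≤ w := by positivity
  have hw1 : w < 1 := (div_lt_one (by positivity)).2 (by linarith)
  set B : ℕ → ℝ := fun n => ∫ u in Set.Ioi (1 : ℝ), (u ^ β)⁻¹ * (1 - (u ^ β)⁻¹) ^ n with hB
  have hpos : ∀ u ∈ Set.Ioi (1 : ℝ), 0 < (u ^ β)⁻¹ ∧ (u ^ β)⁻¹ < 1 := by
    intro u hu
    have hu1 : 1 < u ^ β := Real.one_lt_rpow hu (by linarith)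
    exact ⟨by positivity, inv_lt_one_of_one_lt₀ hu1⟩
  have hB0 : ∀ n, 0 ≤ B n := fun n => setIntegral_nonneg measurableSet_Ioi fun u hu =>
    mul_nonneg (hpos u hu).1.le (pow_nonneg (sub_nonneg.2 (hpos u hu).2.le) _)
  have hBle : ∀ n, B n ≤ B 0 := fun n => setIntegral_mono_on (integrableOn_beta hβ n)
    (integrableOn_beta hβ 0) measurableSet_Ioi fun u hu => by
      obtain ⟨h0, h1⟩ := hpos u hu
      rw [pow_zero]
      exact mul_le_mul_of_nonneg_left (pow_le_one₀ (by linarith) (by linarith)) h0.le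
  have hI : HasSum (fun n => w ^ (n + 1) * B n) (∫ u in Set.Ioi (1 : ℝ), s / (s + u ^ β)) := by
    have h := hasSum_integral_of_summable_integral_norm (μ := volume.restrict (Set.Ioi (1 : ℝ)))
      (F := fun (n : ℕ) u => w ^ (n + 1) * ((u ^ β)⁻¹ * (1 - (u ^ β)⁻¹) ^ n))
      (fun n => (integrableOn_beta hβ n).const_mul _) ?_
    · simp only [integral_const_mul] at h
      convert! h using 1
      refine setIntegral_congr_fun measurableSet_Ioi fun u hu => ?_
      obtain ⟨h0, h1⟩ := hpos u hu
      have hq1 : w * (1 - (u ^ β)⁻¹) < 1 := by nlinarith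
      have := (hasSum_geometric_of_lt_one (mul_nonneg hw0 (by linarith)) hq1).mul_left
        (w * (u ^ β)⁻¹)
      rw [tsum_congr (g := fun n => w * (u ^ β)⁻¹ * (w * (1 - (u ^ β)⁻¹)) ^ n), this.tsum_eq]
      · have hu0 : 0 < u ^ β := inv_pos.1 h0
        have e : 1 - w * (1 - (u ^ β)⁻¹) = (u ^ β + s) / ((1 + s) * u ^ β) := by
          rw [hw]; field_simp; ring
        rw [e, hw]
        field_simp
        rw [add_comm]
      · intro n
        rw [mul_pow]
        ring
    · have e : ∀ n : ℕ, ∫ u in Set.Ioi (1 : ℝ), ‖w ^ (n + 1) * ((u ^ β)⁻¹ * (1 - (u ^ β)⁻¹) ^ n)‖ =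
          w ^ (n + 1) * B n := by
        intro n
        rw [hB, ← integral_const_mul]
        refine setIntegral_congr_fun measurableSet_Ioi fun u hu => ?_
        obtain ⟨h0, h1⟩ := hpos u hu
        exact Real.norm_of_nonneg (mul_nonneg (by positivity)
          (mul_nonneg h0.le (pow_nonneg (by linarith) _)))
      simp_rw [e]
      refine Summable.of_nonneg_of_le (fun n => mul_nonneg (by positivity) (hB0 n)) (fun n => ?_)
        (((summable_nat_add_iff 1).2 (summable_geometric_of_lt_one hw0 hw1)).mul_right (B 0))
      exact mul_le_mul_of_nonneg_left (hBle n) (by positivity)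
  set A : ℕ → ℝ := fun n => 1 + ∑ k ∈ Finset.range n, B k with hA
  have hA0 : ∀ n, 0 ≤ A n := fun n => add_nonneg zero_le_one (Finset.sum_nonneg fun k _ => hB0 k)
  have hAs : Summable fun n => A n * w ^ n := by
    have h1 := (summable_geometric_of_lt_one hw0 hw1)
    have h2 := (summable_pow_mul_geometric_of_norm_lt_one 1
      (by rwa [Real.norm_of_nonneg hw0] : ‖w‖ < 1)).mul_left (B 0)
    refine Summable.of_nonneg_of_le (fun n => mul_nonneg (hA0 n) (by positivity)) (fun n => ?_)
      (h1.add h2)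
    have : A n ≤ 1 + n * B 0 := by
      simp only [A]
      gcongr
      refine (Finset.sum_le_sum fun k _ => hBle k).trans (by simp)
    calc A n * w ^ n ≤ (1 + n * B 0) * w ^ n := by gcongr
      _ = _ := by ring
  have hmain : (1 - w) * ∑' n, A n * w ^ n = 1 + ∫ u in Set.Ioi (1 : ℝ), s / (s + u ^ β) := by
    rw [← hI.tsum_eq, sub_mul, one_mul, ← tsum_mul_left]
    nth_rewrite 1 [hAs.tsum_eq_zero_add]
    rw [show A 0 * w ^ 0 = 1 by simp [A], add_sub_assoc,
      ← ((summable_nat_add_iff 1).2 hAs).tsum_sub (hAs.mul_left w)]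
    congr 1
    refine tsum_congr fun n => ?_
    simp only [A, Finset.sum_range_succ]
    ring
  have hz : -s / (-s - 1) = w := by
    rw [hw, ← neg_div_neg_eq]; congr 1; ring; ring
  rw [← hmain, gaussHypergeometric, if_neg (by rw [abs_neg, abs_of_pos hs0]; linarith), hz,
    ordinaryHypergeometric_eq_tsum, Real.rpow_neg (by linarith), Real.rpow_one]
  congr 1
  · have : 1 + s ≠ 0 := by positivity
    rw [hw, sub_neg_eq_add]
    field_simp
    ring
  · refine tsum_congr fun n => ?_
    rw [sub_neg_eq_add, sub_add_cancel, ascPochhammer_eval_one,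
      inv_mul_cancel₀ (by positivity), one_mul, factorial_div_ascPochhammer_eq hβ, smul_eq_mul]

lemma gaussHypergeometric_eq_one_add_integral {β : ℝ} (hβ : 1 < β) {s : ℝ} (hs : 0 ≤ s) :
    gaussHypergeometric 1 (-(1 / β)) (1 - 1 / β) (-s) =
      1 + ∫ u in Set.Ioi (1 : ℝ), s / (s + u ^ β) :=
  (lt_or_ge s 1).elim (gaussHypergeometric_of_lt_one hβ hs) (gaussHypergeometric_of_one_le hβ)

lemma lintegral_Ioi_one_div_add_rpow {β : ℝ} (hβ : 1 < β) {s : ℝ} (hs : 0 ≤ s) :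
    ∫⁻ u in Set.Ioi (1 : ℝ), ENNReal.ofReal (s / (s + u ^ β)) =
      ENNReal.ofReal (gaussHypergeometric 1 (-(1 / β)) (1 - 1 / β) (-s) - 1) := by
  rw [gaussHypergeometric_eq_one_add_integral hβ hs, add_sub_cancel_left,
    ofReal_integral_eq_lintegral_ofReal (integrableOn_div_add_rpow hβ hs)]
  filter_upwards [ae_restrict_mem measurableSet_Ioi] with u hu
  have : 0 < u ^ β := Real.rpow_pos_of_pos (zero_lt_one.trans hu) β
  simp only [Pi.zero_apply]
  positivity

lemma one_le_gaussHypergeometric {β : ℝ} (hβ : 1 < β) {s : ℝ} (hs : 0 ≤ s) :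
    1 ≤ gaussHypergeometric 1 (-(1 / β)) (1 - 1 / β) (-s) := by
  rw [gaussHypergeometric_eq_one_add_integral hβ hs, le_add_iff_nonneg_right]
  refine setIntegral_nonneg measurableSet_Ioi fun u hu => ?_
  have : 0 < u ^ β := Real.rpow_pos_of_pos (zero_lt_one.trans hu) β
  positivity

/-- Substitution `t + c = (a + c) u`. It serves both kernels: `a = 0` without cutoff, `a = s` with
interferers beyond the serving station. -/
lemma lintegral_Ioi_interference {β : ℝ} (hβ : 1 < β) {K : ℝ} (hK : 0 ≤ K) {a c : ℝ}
    (hac : 0 < a + c) :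
    ∫⁻ t in Set.Ioi a, ENNReal.ofReal (1 - 1 / (1 + K / (t + c) ^ β)) =
      ENNReal.ofReal ((a + c) *
        (gaussHypergeometric 1 (-(1 / β)) (1 - 1 / β) (-(K / (a + c) ^ β)) - 1)) := by
  have hpos : 0 < (a + c) ^ β := Real.rpow_pos_of_pos hac β
  rw [ENNReal.ofReal_mul hac.le, ← lintegral_Ioi_one_div_add_rpow hβ (by positivity)]
  have himg : (fun u : ℝ => (a + c) * u + -c) '' Set.Ioi 1 = Set.Ioi a := by
    ext t
    simp only [Set.mem_image, Set.mem_Ioi]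
    constructor
    · rintro ⟨u, hu, rfl⟩
      nlinarith
    · intro ht
      refine ⟨(t + c) / (a + c), ?_, by field_simp; ring⟩
      rw [one_lt_div hac]
      linarith
  rw [← himg, lintegral_image_eq_lintegral_abs_deriv_mul measurableSet_Ioi (f' := fun _ => a + c)
    (fun u _ => (((hasDerivAt_id' u).const_mul (a + c)).add_const (-c)).hasDerivWithinAt.congr_deriv
      (mul_one _))
    (fun u _ v _ h => by
      have := add_right_cancel h
      exact mul_left_cancel₀ hac.ne' this)]
  rw [abs_of_pos hac, lintegral_const_mul' _ _ ENNReal.ofReal_ne_top]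
  congr 1
  refine setLIntegral_congr_fun measurableSet_Ioi fun u hu => ?_
  have hu0 : 0 < u := zero_lt_one.trans hu
  have hub : 0 < u ^ β := Real.rpow_pos_of_pos hu0 β
  congr 1
  rw [neg_add_cancel_right, Real.mul_rpow hac.le hu0.le]
  have : 0 < K / (a + c) ^ β + u ^ β := by positivity
  have : 0 < K + (a + c) ^ β * u ^ β := by positivity
  field_simp
  ring

/-! ### The interference kernels -/

/-- The Laplace factor contributed by an interferer at squared distance `t` when the serving base
station is at squared distance `s`, for squared height `c` and pathloss exponent `2 * β`. -/
def fadingKernel (β θ c s t : ℝ) : ℝ := 1 / (1 + θ * ((s + c) / (t + c)) ^ β)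

/-- The kernel `fadingKernel`, cut off where the interferer is closer than the serving station. -/
def closestKernel (β θ c s t : ℝ) : ℝ := if s ≤ t then fadingKernel β θ c s t else 0

section

variable {β θ c s t : ℝ}

lemma fadingKernel_nonneg (hθ : 0 ≤ θ) (hc : 0 ≤ c) (hs : 0 ≤ s) (ht : 0 ≤ t) :
    0 ≤ fadingKernel β θ c s t := by
  unfold fadingKernel; positivity

lemma fadingKernel_le_one (hθ : 0 ≤ θ) (hc : 0 ≤ c) (hs : 0 ≤ s) (ht : 0 ≤ t) :
    fadingKernel β θ c s t ≤ 1 := by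
  have : 0 ≤ θ * ((s + c) / (t + c)) ^ β := by positivity
  exact (div_le_one (by linarith)).2 (by linarith)

/-- `h` excludes a zero denominator, where the kernel takes the default value `1` and monotonicity
in `t` can fail; if `s + c = 0`, both kernel values are `1` anyway. -/
lemma fadingKernel_mono (hβ : 0 < β) (hθ : 0 ≤ θ) (hc : 0 ≤ c) {s' t' : ℝ} (hs' : 0 ≤ s')
    (hs : s' ≤ s) (ht : 0 ≤ t) (ht' : t ≤ t') (h : 0 < t + c ∨ s + c = 0) :
    fadingKernel β θ c s t ≤ fadingKernel β θ c s' t' := by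
  have hd : (s' + c) / (t' + c) ≤ (s + c) / (t + c) := by
    rcases h with h | h
    · exact div_le_div₀ (by linarith) (by linarith) h (by linarith)
    · rw [show s' + c = 0 by linarith, zero_div]
      exact div_nonneg (by linarith) (by linarith)
  have h0 : 0 ≤ (s' + c) / (t' + c) := div_nonneg (by linarith) (by linarith)
  unfold fadingKernel
  gcongr

lemma measurable_fadingKernel (β θ c : ℝ) : Measurable (Function.uncurry (fadingKernel β θ c)) := by
  unfold fadingKernel Function.uncurry
  fun_prop

lemma tendsto_fadingKernel (hβ : 0 < β) (hθ : 0 ≤ θ) (hc : 0 ≤ c) (hs : 0 ≤ s) (ht : 0 ≤ t)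
    (h : 0 < t + c ∨ s + c = 0) :
    Filter.Tendsto (fun n => fadingKernel β θ c (dyadicLo n s) (dyadicHi n t)) Filter.atTop
      (nhds (fadingKernel β θ c s t)) := by
  rcases h with h | h
  · have hd : Filter.Tendsto (fun n => (dyadicLo n s + c) / (dyadicHi n t + c)) Filter.atTop
        (nhds ((s + c) / (t + c))) :=
      ((tendsto_dyadicLo hs).add_const c).div ((tendsto_dyadicHi ht).add_const c) h.ne'
    have hr := ((hd.rpow_const (p := β) (Or.inr hβ.le)).const_mul θ).const_add 1
    exact tendsto_const_nhds.div hr (by positivity)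
  · have hs0 : s = 0 := by linarith
    have hc0 : c = 0 := by linarith
    subst hs0 hc0
    have : ∀ n, dyadicLo n 0 = 0 := fun n => by simp [dyadicLo]
    simp [fadingKernel, this]

lemma isMonotoneKernel_fadingKernel (hβ : 0 < β) (hθ : 0 ≤ θ) (hc : 0 < c) :
    IsMonotoneKernel (fadingKernel β θ c) where
  nonneg _ _ hs ht := fadingKernel_nonneg hθ hc.le hs ht
  le_one _ _ hs ht := fadingKernel_le_one hθ hc.le hs ht
  mono _ _ _ _ hs' hs ht ht' := fadingKernel_mono hβ hθ hc.le hs' hs ht ht' (Or.inl (by linarith))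
  measurable := measurable_fadingKernel β θ c
  tendsto _ _ hs ht := tendsto_fadingKernel hβ hθ hc.le hs ht (Or.inl (by linarith))

/-- For `s ≤ t` the denominator vanishes only together with the numerator; hence the cut-off kernel
is admissible even at height zero. -/
lemma add_pos_or_add_eq_zero (hc : 0 ≤ c) (hs : 0 ≤ s) (h : s ≤ t) : 0 < t + c ∨ s + c = 0 := by
  by_cases h0 : s + c = 0
  · exact Or.inr h0
  · exact Or.inl (lt_of_lt_of_le (lt_of_le_of_ne (by linarith) (Ne.symm h0)) (by linarith))

lemma isMonotoneKernel_closestKernel (hβ : 0 < β) (hθ : 0 ≤ θ) (hc : 0 ≤ c) :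
    IsMonotoneKernel (closestKernel β θ c) where
  nonneg s t hs ht := by
    unfold closestKernel
    split_ifs; exacts [fadingKernel_nonneg hθ hc hs ht, le_rfl]
  le_one s t hs ht := by
    unfold closestKernel
    split_ifs; exacts [fadingKernel_le_one hθ hc hs ht, zero_le_one]
  mono s s' t t' hs' hs ht ht' := by
    unfold closestKernel
    split_ifs with h1 h2 h2
    · exact fadingKernel_mono hβ hθ hc hs' hs ht ht' (add_pos_or_add_eq_zero hc (hs'.trans hs) h1)
    · exact absurd (hs.trans (h1.trans ht')) h2
    · exact fadingKernel_nonneg hθ hc hs' (ht.trans ht')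
    · exact le_rfl
  measurable := Measurable.ite (measurableSet_le measurable_fst measurable_snd)
    (measurable_fadingKernel β θ c) measurable_const
  tendsto s t hs ht := by
    unfold closestKernel
    split_ifs with h
    · refine (tendsto_fadingKernel hβ hθ hc hs ht (add_pos_or_add_eq_zero hc hs h)).congr fun n => ?_
      rw [if_pos ((dyadicLo_le n hs).trans (h.trans (lt_dyadicHi n t).le))]
    · refine tendsto_const_nhds.congr' ?_
      filter_upwards [(tendsto_dyadicHi ht).eventually_lt (tendsto_dyadicLo hs) (not_le.1 h)] with n hn
      rw [if_neg (not_le.2 hn)]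

/-! ### Integrals of the kernels -/

lemma fadingKernel_eq (hs : 0 ≤ s + c) (ht : 0 ≤ t + c) :
    fadingKernel β θ c s t = 1 / (1 + θ * (s + c) ^ β / (t + c) ^ β) := by
  rw [fadingKernel, Real.div_rpow hs ht, mul_div_assoc]

lemma lintegral_one_sub_fadingKernel (hβ : 1 < β) (hθ : 0 ≤ θ) (hc : 0 < c) (hs : 0 ≤ s) :
    ∫⁻ t in Set.Ici 0, ENNReal.ofReal (1 - fadingKernel β θ c s t) =
      ENNReal.ofReal (c * (gaussHypergeometric 1 (-(1 / β)) (1 - 1 / β)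
        (-(θ * (s + c) ^ β / c ^ β)) - 1)) := by
  have h := lintegral_Ioi_interference hβ (K := θ * (s + c) ^ β) (by positivity) (a := 0) (c := c)
    (by linarith)
  rw [zero_add] at h
  rw [← h, setLIntegral_congr (Ioi_ae_eq_Ici (μ := volume)).symm]
  refine setLIntegral_congr_fun measurableSet_Ioi fun t ht => ?_
  have ht0 : (0 : ℝ) < t := ht
  simp only [fadingKernel_eq (β := β) (θ := θ) (show 0 ≤ s + c by linarith)
    (show 0 ≤ t + c by linarith)]

/-- The void `[0, s)` contributes `s`; beyond it, scaling leaves the argument `-θ` independent of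
`s`. -/
lemma lintegral_one_sub_closestKernel (hβ : 1 < β) (hθ : 0 ≤ θ) (hc : 0 ≤ c) (hs : 0 ≤ s) :
    ∫⁻ t in Set.Ici 0, ENNReal.ofReal (1 - closestKernel β θ c s t) =
      ENNReal.ofReal (s + (s + c) * (gaussHypergeometric 1 (-(1 / β)) (1 - 1 / β) (-θ) - 1)) := by
  have hη := one_le_gaussHypergeometric hβ hθ
  rw [← Set.Ico_union_Ici_eq_Ici hs, lintegral_union measurableSet_Ici
      (Set.disjoint_left.2 fun s hs hs' => not_lt_of_ge hs' hs.2),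
    ENNReal.ofReal_add hs (mul_nonneg (by linarith) (by linarith))]
  congr 1
  · rw [setLIntegral_congr_fun (g := fun _ => 1) measurableSet_Ico]
    · simp
    · intro t ht
      simp [closestKernel, not_le.2 ht.2]
  · rw [setLIntegral_congr (Ioi_ae_eq_Ici (μ := volume)).symm]
    by_cases h0 : s + c = 0
    · have : ∀ t, fadingKernel β θ c s t = 1 := fun t => by
        simp [fadingKernel, h0, Real.zero_rpow (by linarith : β ≠ 0)]
      rw [setLIntegral_congr_fun (g := fun _ => 0) measurableSet_Ioi]
      · simp [h0]
      · intro t ht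
        simp [closestKernel, le_of_lt (show s < t from ht), this]
    · have hsc : 0 < s + c := lt_of_le_of_ne (by linarith) (Ne.symm h0)
      have h := lintegral_Ioi_interference hβ (K := θ * (s + c) ^ β) (by positivity) hsc
      have hp : 0 < (s + c) ^ β := Real.rpow_pos_of_pos hsc β
      rw [mul_div_cancel_right₀ _ hp.ne'] at h
      rw [← h]
      refine setLIntegral_congr_fun measurableSet_Ioi fun t ht => ?_
      have ht0 : s < t := ht
      simp only [closestKernel, ht0.le, if_true, fadingKernel_eq (β := β) (θ := θ) hsc.le
        (show 0 ≤ t + c by linarith)]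

/-- The exponent is `-μ (η s + c (η - 1))`, so the integrand is a multiple of the exponential
density of rate `μ η`. -/
lemma lintegral_exp_closestKernel (hβ : 1 < β) (hθ : 0 ≤ θ) (hc : 0 ≤ c) {μ : ℝ≥0} (hμ : 0 < μ) :
    ∫⁻ s in Set.Ici (0 : ℝ), ENNReal.ofReal (μ * Real.exp (-(μ *
        (∫⁻ t in Set.Ici 0, ENNReal.ofReal (1 - closestKernel β θ c s t)).toReal))) =
      ENNReal.ofReal (1 / gaussHypergeometric 1 (-(1 / β)) (1 - 1 / β) (-θ) *
        Real.exp (-(μ * c * (gaussHypergeometric 1 (-(1 / β)) (1 - 1 / β) (-θ) - 1)))) := by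
  have hη := one_le_gaussHypergeometric hβ hθ
  have hI := fun s (hs : 0 ≤ s) => lintegral_one_sub_closestKernel hβ hθ hc hs
  set η := gaussHypergeometric 1 (-(1 / β)) (1 - 1 / β) (-θ)
  have hμη : 0 < μ * η := mul_pos (NNReal.coe_pos.2 hμ) (by linarith)
  have hη0 : 0 < η := by linarith
  rw [← lintegral_indicator measurableSet_Ici]
  have e : ∀ s, (Set.Ici (0 : ℝ)).indicator (fun s => ENNReal.ofReal (μ * Real.exp (-(μ *
        (∫⁻ t in Set.Ici 0, ENNReal.ofReal (1 - closestKernel β θ c s t)).toReal)))) s =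
      ENNReal.ofReal (1 / η * Real.exp (-(μ * c * (η - 1)))) * exponentialPDF (μ * η) s := by
    intro s
    by_cases hs : 0 ≤ s
    · rw [Set.indicator_of_mem (Set.mem_Ici.2 hs), exponentialPDF_of_nonneg hs, hI s hs,
        ENNReal.toReal_ofReal (add_nonneg hs (mul_nonneg (by linarith) (by linarith))),
        ← ENNReal.ofReal_mul (by positivity)]
      congr 1
      rw [show -((μ : ℝ) * (s + (s + c) * (η - 1))) = -(μ * c * (η - 1)) + -(μ * η * s) by ring,
        Real.exp_add]
      field_simp
    · rw [Set.indicator_of_notMem (mt Set.mem_Ici.1 hs), exponentialPDF_of_neg (not_le.1 hs), mul_zero]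
  rw [lintegral_congr e, lintegral_const_mul' _ _ ENNReal.ofReal_ne_top,
    lintegral_exponentialPDF_eq_one hμη, mul_one]

/-- For `t ≤ s` the kernel is at most `1 / (1 + θ)`. The resulting linear growth in `s` gives
Gaussian decay in `r`, hence finiteness of `J`. -/
lemma le_toReal_lintegral_one_sub_fadingKernel (hβ : 1 < β) (hθ : 0 ≤ θ) (hc : 0 < c)
    (hs : 0 ≤ s) :
    θ / (1 + θ) * s ≤ (∫⁻ t in Set.Ici 0, ENNReal.ofReal (1 - fadingKernel β θ c s t)).toReal := by
  have hfin : ∫⁻ t in Set.Ici 0, ENNReal.ofReal (1 - fadingKernel β θ c s t) ≠ ∞ := by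
    rw [lintegral_one_sub_fadingKernel hβ hθ hc hs]; exact ENNReal.ofReal_ne_top
  rw [← ENNReal.ofReal_le_iff_le_toReal hfin]
  calc ENNReal.ofReal (θ / (1 + θ) * s)
      = ∫⁻ _ in Set.Icc 0 s, ENNReal.ofReal (θ / (1 + θ)) := by
        rw [setLIntegral_const, Real.volume_Icc, sub_zero, ENNReal.ofReal_mul (by positivity)]
    _ ≤ ∫⁻ t in Set.Icc 0 s, ENNReal.ofReal (1 - fadingKernel β θ c s t) := by
        refine setLIntegral_mono' measurableSet_Icc fun t ht => ENNReal.ofReal_le_ofReal ?_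
        have ht0 := ht.1
        have h1 : 1 ≤ ((s + c) / (t + c)) ^ β :=
          Real.one_le_rpow ((one_le_div (by linarith)).2 (by linarith [ht.2])) (by linarith)
        have h2 : fadingKernel β θ c s t ≤ 1 / (1 + θ) := by
          unfold fadingKernel
          gcongr
          exact le_mul_of_one_le_right hθ h1
        have h3 : θ / (1 + θ) = 1 - 1 / (1 + θ) := by field_simp; ring
        linarith
    _ ≤ _ := lintegral_mono_set Set.Icc_subset_Ici_self

end

/-! ### The integral `J` in the radial variable -/

section

variable {α θ h : ℝ}

lemma eta_eq_one_one (α θ : ℝ) :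
    eta α θ 1 1 = gaussHypergeometric 1 (-(1 / (α / 2))) (1 - 1 / (α / 2)) (-θ) := by
  rw [eta, Real.one_rpow, one_div_div]
  simp

/-- In `J` the variable `r` is the slant distance to the station, height included, so the squared
horizontal distance is `r ^ 2 - h ^ 2`. -/
lemma mul_eta_eq_toReal_lintegral (hα : 2 < α) (hθ : 0 ≤ θ) (hh : 0 < h) {r : ℝ} (hr : h ≤ r) :
    h ^ 2 * (eta α (θ * r ^ α) 1 h - 1) = (∫⁻ t in Set.Ici 0,
      ENNReal.ofReal (1 - fadingKernel (α / 2) θ (h ^ 2) (r ^ 2 - h ^ 2) t)).toReal := by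
  have hr0 : 0 < r := hh.trans_le hr
  have hβ : 1 < α / 2 := by linarith
  have e : ∀ u : ℝ, 0 < u → (u ^ 2) ^ (α / 2) = u ^ α := fun u hu => by
    rw [← Real.rpow_natCast, ← Real.rpow_mul hu.le]
    congr 1
    push_cast
    ring
  rw [lintegral_one_sub_fadingKernel hβ hθ (by positivity) (by nlinarith), sub_add_cancel, e r hr0,
    e h hh, ENNReal.toReal_ofReal, eta, one_mul, one_div_div]
  have := one_le_gaussHypergeometric hβ (s := θ * r ^ α / h ^ α) (by positivity)
  exact mul_nonneg (by positivity) (by linarith)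

lemma integrableOn_exp_eta (hα : 2 < α) (hθ : 0 < θ) (hh : 0 < h) {μ : ℝ≥0} (hμ : 0 < μ) :
    IntegrableOn (fun r : ℝ => Real.exp (-(μ * h ^ 2 * (eta α (θ * r ^ α) 1 h - 1))) * r)
      (Set.Ioi h) := by
  -- Measurability and the Gaussian bound are obtained for `D`, a parametric integral, and
  -- transferred to `eta` at the end.
  set D : ℝ → ℝ := fun s => (∫⁻ t in Set.Ici 0,
      ENNReal.ofReal (1 - fadingKernel (α / 2) θ (h ^ 2) s t)).toReal with hD
  have hDm : Measurable D := by
    have : Measurable fun s => ∫⁻ t in Set.Ici 0,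
        ENNReal.ofReal (1 - fadingKernel (α / 2) θ (h ^ 2) s t) :=
      Measurable.lintegral_prod_right'
        (f := fun p : ℝ × ℝ => ENNReal.ofReal (1 - fadingKernel (α / 2) θ (h ^ 2) p.1 p.2))
        (measurable_const.sub (measurable_fadingKernel _ _ _)).ennreal_ofReal
    exact this.ennreal_toReal
  have hμ0 : (0 : ℝ) < μ := NNReal.coe_pos.2 hμ
  have hE : IntegrableOn (fun r : ℝ => Real.exp (-(μ * D (r ^ 2 - h ^ 2))) * r) (Set.Ioi h) := by
    set b := μ * (θ / (1 + θ)) with hb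
    have hb0 : 0 < b := by positivity
    refine (((integrable_mul_exp_neg_mul_sq hb0).const_mul (Real.exp (b * h ^ 2))).integrableOn
      (s := Set.Ioi h)).mono' ?_ ?_
    · exact (((measurable_const.mul (hDm.comp (by fun_prop))).neg.exp).mul
        measurable_id).aestronglyMeasurable
    · filter_upwards [ae_restrict_mem measurableSet_Ioi] with r hr
      have hr0 : 0 < r := hh.trans hr
      have hr' : h < r := hr
      have hl := le_toReal_lintegral_one_sub_fadingKernel (β := α / 2) (c := h ^ 2) (s := r ^ 2 - h ^ 2)
        (by linarith) hθ.le (by positivity) (by nlinarith)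
      rw [Real.norm_of_nonneg (by positivity)]
      have : Real.exp (-(μ * D (r ^ 2 - h ^ 2))) ≤ Real.exp (b * h ^ 2) * Real.exp (-b * r ^ 2) := by
        rw [← Real.exp_add]
        refine Real.exp_le_exp.2 ?_
        have := mul_le_mul_of_nonneg_left hl hμ0.le
        rw [hb]
        simp only [D]
        linarith
      calc _ ≤ Real.exp (b * h ^ 2) * Real.exp (-b * r ^ 2) * r := by gcongr
        _ = _ := by ring
  refine hE.congr_fun (fun r hr => ?_) measurableSet_Ioi
  simp only [D, mul_assoc, mul_eta_eq_toReal_lintegral hα hθ.le hh (le_of_lt hr)]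

lemma lintegral_exp_fadingKernel (hα : 2 < α) (hθ : 0 < θ) (hh : 0 < h) {μ : ℝ≥0} (hμ : 0 < μ) :
    ∫⁻ s in Set.Ici (0 : ℝ), ENNReal.ofReal (μ * Real.exp (-(μ * (∫⁻ t in Set.Ici 0,
        ENNReal.ofReal (1 - fadingKernel (α / 2) θ (h ^ 2) s t)).toReal))) =
      ENNReal.ofReal (2 * μ * ∫ r in Set.Ioi h,
        Real.exp (-(μ * h ^ 2 * (eta α (θ * r ^ α) 1 h - 1))) * r) := by
  have himg : (fun r : ℝ => r ^ 2 - h ^ 2) '' Set.Ioi h = Set.Ioi 0 := by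
    ext s
    simp only [Set.mem_image, Set.mem_Ioi]
    constructor
    · rintro ⟨r, hr, rfl⟩
      nlinarith
    · intro hs
      refine ⟨√(s + h ^ 2), Real.lt_sqrt_of_sq_lt (by linarith), ?_⟩
      rw [Real.sq_sqrt (by positivity)]
      ring
  rw [setLIntegral_congr (Ioi_ae_eq_Ici (μ := volume)).symm, ← himg,
    lintegral_image_eq_lintegral_abs_deriv_mul measurableSet_Ioi (f' := fun r => 2 * r)
    (fun r _ => by simpa using (((hasDerivAt_pow 2 r).sub_const (h ^ 2)).hasDerivWithinAt))
    (fun u hu v hv e => by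
      have hu' : h < u := hu
      have hv' : h < v := hv
      have : u ^ 2 = v ^ 2 := sub_left_injective e
      exact (pow_left_inj₀ (by linarith) (by linarith) two_ne_zero).1 this),
    ENNReal.ofReal_mul (by positivity),
    ofReal_integral_eq_lintegral_ofReal (integrableOn_exp_eta hα hθ hh hμ),
    ← lintegral_const_mul' _ _ ENNReal.ofReal_ne_top]
  · refine setLIntegral_congr_fun measurableSet_Ioi fun r hr => ?_
    have hr0 : 0 < r := hh.trans hr
    rw [← mul_eta_eq_toReal_lintegral hα hθ.le hh (le_of_lt hr), abs_of_pos (by positivity),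
      ← ENNReal.ofReal_mul (by positivity), ← ENNReal.ofReal_mul (by positivity), ← mul_assoc (μ : ℝ)]
    congr 1
    ring
  · filter_upwards [ae_restrict_mem measurableSet_Ioi] with r hr
    have hr0 : 0 < r := hh.trans hr
    simp only [Pi.zero_apply]
    positivity

end

/-! ### Coverage probabilities -/

section

variable {Ω : Type*} {α h θ : ℝ} {x : ℕ → Ω → Plane} {g : ℕ → Ω → ℝ}

lemma pathloss_pos {r : ℝ} (hr : 0 < r ^ 2 + h ^ 2) : 0 < pathloss α h r :=
  Real.rpow_pos_of_pos hr _

lemma one_div_one_add_pathloss {s t : ℝ} (hs : 0 < s ^ 2 + h ^ 2) (ht : 0 < t ^ 2 + h ^ 2) :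
    1 / (1 + θ * pathloss α h t / pathloss α h s) =
      fadingKernel (α / 2) θ (h ^ 2) (s ^ 2) (t ^ 2) := by
  rw [fadingKernel, pathloss, pathloss, Real.rpow_neg hs.le, Real.rpow_neg ht.le,
    Real.div_rpow hs.le ht.le]
  congr 2
  rw [mul_div_assoc, inv_div_inv]

/-- One strictly closer point suffices to put a zero factor into the product. -/
lemma prodNe_closestKernel {β c : ℝ} (T : ℕ → ℝ) (i : ℕ) :
    prodNe (fun j => closestKernel β θ c (T i) (T j)) i =
      {k | ∀ j, T k ≤ T j}.indicator
        (fun i => prodNe (fun j => fadingKernel β θ c (T i) (T j)) i) i := by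
  by_cases hi : ∀ j, T i ≤ T j
  · rw [Set.indicator_of_mem (by exact hi)]
    simp [closestKernel, hi]
  · rw [Set.indicator_of_notMem (by exact hi)]
    push Not at hi
    obtain ⟨j, hj⟩ := hi
    refine le_antisymm ((iInf_le _ (j + 1)).trans (le_of_eq ?_)) zero_le
    rw [Finset.prod_eq_zero (i := j)]
    · simp
    · simp only [Finset.mem_erase, Finset.mem_range, lt_add_iff_pos_right, zero_lt_one, and_true]
      rintro rfl
      exact lt_irrefl _ hj
    · simp [closestKernel, not_le.2 hj]

lemma isClosest_iff_sq {i : ℕ} {ω : Ω} :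
    IsClosest x i ω ↔ ∀ j, ‖x i ω‖ ^ 2 ≤ ‖x j ω‖ ^ 2 :=
  forall_congr' fun j => (pow_le_pow_iff_left₀ (norm_nonneg (x i ω)) (norm_nonneg (x j ω))
    two_ne_zero).symm

/-- An SIR above one means more power than all other stations together, and two stations cannot each
be strictly stronger than the other. -/
lemma eq_of_one_lt_sir {i j : ℕ} {ω : Ω} (hi : 1 < sir α h x g i ω) (hj : 1 < sir α h x g j ω) :
    i = j := by
  by_contra hij
  have key : ∀ {i j : ℕ}, i ≠ j → 1 < sir α h x g i ω →
      receivedPower α h x g j ω < receivedPower α h x g i ω := by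
    intro i j hij hi
    have hlt : interference α h x g i ω < receivedPower α h x g i ω := by
      by_contra hle
      exact not_le_of_gt hi (ENNReal.div_le_of_le_mul (by rw [one_mul]; exact not_lt.1 hle))
    exact lt_of_le_of_lt (ENNReal.le_tsum (f := fun k : {k : ℕ // k ≠ i} =>
      receivedPower α h x g k ω) ⟨j, Ne.symm hij⟩) hlt
  exact lt_asymm (key hij hi) (key (Ne.symm hij) hj)

variable [MeasurableSpace Ω] {P : Measure Ω} {lam : ℝ≥0}

/-- The origin has area zero, so its count is Poisson with mean `0`. At `h = 0` this avoids the
default value of `pathloss` at distance zero. -/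
lemma IsHomogeneousPPP.ae_forall_ne_zero (hx : IsHomogeneousPPP P lam x) :
    ∀ᵐ ω ∂P, ∀ i, x i ω ≠ 0 := by
  have hlaw := hx.count_law {0} (measurableSet_singleton 0) (by simp)
  rw [measure_singleton, ENNReal.toNNReal_zero, mul_zero] at hlaw
  let φ : ℕ∞ → ℝ≥0∞ := fun n => if n = 0 then 0 else 1
  have hl : ∫⁻ ω, φ (pointCount x {0} ω) ∂P = _ := lintegral_comp_of_hasLaw_poisson hlaw φ
  rw [tsum_congr (g := fun _ => 0) (fun n => by cases n <;> simp [φ]), tsum_zero] at hl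
  have hφ : AEMeasurable (fun ω => φ (pointCount x {0} ω)) P :=
    (Measurable.of_discrete : Measurable φ).comp_aemeasurable hlaw.aemeasurable
  filter_upwards [(lintegral_eq_zero_iff' hφ).1 hl] with ω hω i hi
  have h0 : pointCount x {0} ω = 0 := by
    by_contra hne
    simp [φ, hne] at hω
  rw [pointCount, Set.encard_eq_zero] at h0
  exact Set.eq_empty_iff_forall_notMem.1 h0 i hi

lemma IsHomogeneousPPP.measurableSet_isClosest (hx : IsHomogeneousPPP P lam x) (i : ℕ) :
    MeasurableSet {ω | IsClosest x i ω} := by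
  simp only [IsClosest, Set.ofPred_forall]
  exact .iInter fun j => measurableSet_le (hx.measurable_point i).norm (hx.measurable_point j).norm

/-- By Borel–Cantelli only finitely many points lie below each level, so the minimum distance is
attained. -/
lemma IsHomogeneousPPP.ae_exists_isClosest (hx : IsHomogeneousPPP P lam x) :
    ∀ᵐ ω ∂P, ∃ i, IsClosest x i ω := by
  have hfin : ∀ᵐ ω ∂P, ∀ M : ℕ, {i | ‖x i ω‖ ^ 2 < M}.Finite :=
    ae_all_iff.2 fun M => ae_finite_setOfPred_mem (tsum_measure_lt_ne_top hx.isDyadicPoisson M)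
  filter_upwards [hfin] with ω hω
  obtain ⟨M, hM⟩ := exists_nat_gt (‖x 0 ω‖ ^ 2)
  obtain ⟨i, hi, hmin⟩ := Set.exists_min_image _ (fun i => ‖x i ω‖ ^ 2) (hω M) ⟨0, hM⟩
  refine ⟨i, isClosest_iff_sq.2 fun j => ?_⟩
  rcases lt_or_ge (‖x j ω‖ ^ 2) M with hj | hj
  · exact hmin j hj
  · exact (le_of_lt hi).trans hj

lemma IsRayleighMarkedPPP.measurable_receivedPower (hxg : IsRayleighMarkedPPP P lam x g) (i : ℕ) :
    Measurable (receivedPower α h x g i) := by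
  have h1 := hxg.measurable_gain i
  have h2 := (hxg.ppp.measurable_point i).norm
  unfold receivedPower pathloss
  fun_prop

lemma IsRayleighMarkedPPP.measurable_sir (hxg : IsRayleighMarkedPPP P lam x g) (i : ℕ) :
    Measurable (sir α h x g i) :=
  (hxg.measurable_receivedPower i).div (.tsum fun j => hxg.measurable_receivedPower j)

/-- A covering station is unique for `θ ≥ 1`, hence also the strongest one, and the number of
covering stations is an indicator. -/
theorem IsRayleighMarkedPPP.coverageStrongest_eq (hxg : IsRayleighMarkedPPP P lam x g)
    (hθ : 1 ≤ θ) :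
    coverageStrongest P α h x g θ = (meanCoveringStations P α h x g θ).toReal := by
  have h1 : (1 : ℝ≥0∞) ≤ ENNReal.ofReal θ := by simpa using hθ
  have hsub : ∀ ω, {i | ENNReal.ofReal θ < sir α h x g i ω}.Subsingleton := fun ω i hi j hj =>
    eq_of_one_lt_sir (lt_of_le_of_lt h1 hi) (lt_of_le_of_lt h1 hj)
  have hset : {ω | ∃ i, IsStrongest α h x g i ω ∧ ENNReal.ofReal θ < sir α h x g i ω} =
      {ω | ∃ i, ENNReal.ofReal θ < sir α h x g i ω} := by
    ext ω
    refine ⟨fun ⟨i, hi⟩ => ⟨i, hi.2⟩, fun ⟨i, hi⟩ => ⟨i, fun j => ?_, hi⟩⟩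
    by_contra hlt
    have hj : ENNReal.ofReal θ < sir α h x g j ω := hi.trans (not_le.1 hlt)
    rw [hsub ω hi hj] at hlt
    exact hlt le_rfl
  have hm : MeasurableSet {ω | ∃ i, ENNReal.ofReal θ < sir α h x g i ω} := by
    rw [Set.ofPred_exists]
    exact .iUnion fun i => measurableSet_lt measurable_const (hxg.measurable_sir i)
  rw [coverageStrongest, hset, measureReal_def, ← lintegral_indicator_one hm, meanCoveringStations]
  congr 1
  refine lintegral_congr fun ω => ?_
  by_cases hω : ∃ i, ENNReal.ofReal θ < sir α h x g i ω
  · obtain ⟨i, hi⟩ := hω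
    rw [Set.indicator_of_mem (by exact ⟨i, hi⟩), (hsub ω).eq_singleton_of_mem hi,
      Set.encard_singleton]
    simp
  · rw [Set.indicator_of_notMem (by exact hω)]
    push Not at hω
    simp [not_lt.2 (hω _)]

variable [IsProbabilityMeasure P]

/-- The probability that station `i` covers the origin and the locations lie in `A`, after averaging
over the fading. -/
lemma IsRayleighMarkedPPP.measure_inter_lt_sir (hxg : IsRayleighMarkedPPP P lam x g) (hθ : 0 < θ)
    (hpos : ∀ᵐ ω ∂P, ∀ i, 0 < ‖x i ω‖ ^ 2 + h ^ 2) {A : Set (ℕ → Plane)} (hA : MeasurableSet A)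
    (i : ℕ) :
    P {ω | (fun j => x j ω) ∈ A ∧ ENNReal.ofReal θ < sir α h x g i ω} =
      ∫⁻ ω, {ω | (fun j => x j ω) ∈ A}.indicator (fun ω => prodNe (fun j =>
        fadingKernel (α / 2) θ (h ^ 2) (‖x i ω‖ ^ 2) (‖x j ω‖ ^ 2)) i) ω ∂P := by
  have hxm : Measurable fun ω j => x j ω := measurable_pi_lambda _ hxg.ppp.measurable_point
  have hgm : Measurable fun ω j => g j ω := measurable_pi_lambda _ hxg.measurable_gain
  set H : Set ((ℕ → Plane) × (ℕ → ℝ)) := {q | q.1 ∈ A ∧ ENNReal.ofReal θ <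
    ENNReal.ofReal (q.2 i * pathloss α h ‖q.1 i‖) /
      ∑' j : {j : ℕ // j ≠ i}, ENNReal.ofReal (q.2 j * pathloss α h ‖q.1 j‖)} with hH
  have hp : ∀ j, Measurable fun q : (ℕ → Plane) × (ℕ → ℝ) =>
      ENNReal.ofReal (q.2 j * pathloss α h ‖q.1 j‖) := by
    intro j
    unfold pathloss
    fun_prop
  have hHm : MeasurableSet H := (measurable_fst hA).inter
    (measurableSet_lt measurable_const (.div (hp i)
      (.tsum fun j : {j : ℕ // j ≠ i} => hp j)))
  -- The joint law of locations and gains is a product, so Tonelli allows the fading to be averaged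
  -- at frozen locations.
  have hprod := (indepFun_iff_map_prod_eq_prod_map_map hxm.aemeasurable hgm.aemeasurable).1 hxg.indep
  change P ((fun ω => (fun j => x j ω, fun j => g j ω)) ⁻¹' H) = _
  rw [← Measure.map_apply (hxm.prodMk hgm) hHm, hprod, Measure.prod_apply hHm,
    lintegral_map (measurable_measure_prodMk_left hHm) hxm]
  refine lintegral_congr_ae ?_
  filter_upwards [hpos] with ω hω
  rw [Measure.map_apply hgm (measurable_prodMk_left hHm)]
  by_cases hωA : (fun j => x j ω) ∈ A
  · rw [Set.indicator_of_mem (by exact hωA)]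
    have hℓ : ∀ j, 0 < pathloss α h ‖x j ω‖ := fun j => pathloss_pos (hω j)
    have hF := measure_tsum_lt_eq_prodNe hxg.measurable_gain hxg.gain_law hxg.gain_indep
      (c := fun j => θ * pathloss α h ‖x j ω‖ / pathloss α h ‖x i ω‖)
      (fun j => div_nonneg (mul_nonneg hθ.le (hℓ j).le) (hℓ i).le) i
    simp only [one_div_one_add_pathloss (hω _) (hω _)] at hF
    rw [← hF]
    congr 1
    ext ω'
    simp only [Set.mem_preimage, H, Set.mem_ofPred_eq, hωA, true_and]
    exact ofReal_lt_sir_iff (a := fun j => g j ω') hℓ hθ i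
  · rw [Set.indicator_of_notMem (by exact hωA)]
    convert! measure_empty (μ := P)
    ext ω'
    simp [H, hωA]

lemma lintegral_tsum_closestKernel (hx : IsHomogeneousPPP P lam x) (hlam : 0 < lam) {β c : ℝ}
    (hβ : 1 < β) (hθ : 0 ≤ θ) (hc : 0 ≤ c) :
    ∫⁻ ω, ∑' i, {ω | IsClosest x i ω}.indicator (fun ω => prodNe (fun j =>
        fadingKernel β θ c (‖x i ω‖ ^ 2) (‖x j ω‖ ^ 2)) i) ω ∂P =
      ENNReal.ofReal (1 / gaussHypergeometric 1 (-(1 / β)) (1 - 1 / β) (-θ) *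
        Real.exp (-(Real.pi * lam * c *
          (gaussHypergeometric 1 (-(1 / β)) (1 - 1 / β) (-θ) - 1)))) := by
  have hμ : 0 < lam * Real.toNNReal Real.pi := mul_pos hlam (Real.toNNReal_pos.2 Real.pi_pos)
  have h1 := lintegral_tsum_prodNe hx.isDyadicPoisson
    (isMonotoneKernel_closestKernel (by linarith : 0 < β) hθ hc) fun s hs => by
      rw [lintegral_one_sub_closestKernel hβ hθ hc hs]; exact ENNReal.ofReal_ne_top
  rw [lintegral_exp_closestKernel hβ hθ hc hμ] at h1
  rw [show Real.pi * lam = ((lam * Real.toNNReal Real.pi : ℝ≥0) : ℝ) by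
    rw [NNReal.coe_mul, Real.coe_toNNReal _ Real.pi_pos.le, mul_comm], ← h1]
  refine lintegral_congr fun ω => tsum_congr fun i => ?_
  rw [prodNe_closestKernel (fun j => ‖x j ω‖ ^ 2) i]
  by_cases hi : IsClosest x i ω
  · rw [Set.indicator_of_mem (by exact hi), Set.indicator_of_mem (by exact isClosest_iff_sq.1 hi)]
  · rw [Set.indicator_of_notMem (by exact hi),
      Set.indicator_of_notMem (by exact mt isClosest_iff_sq.2 hi)]

/-- Mecke's formula at `θ = 0` says that the mean number of closest points is `1`; almost surely
there is at least one, hence exactly one. -/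
lemma IsHomogeneousPPP.ae_isClosest_unique (hx : IsHomogeneousPPP P lam x) (hlam : 0 < lam) :
    ∀ᵐ ω ∂P, ∀ i j, IsClosest x i ω → IsClosest x j ω → i = j := by
  have hN : ∫⁻ ω, ∑' i, {ω | IsClosest x i ω}.indicator 1 ω ∂P ≤ ∫⁻ _, 1 ∂P := by
    -- At `θ = 0` the fading factors are all `1`, so the values of `β` and `c` are immaterial.
    have := lintegral_tsum_closestKernel (β := 2) (c := 0) (θ := 0) hx hlam one_lt_two le_rfl le_rfl
    have h0 := gaussHypergeometric_eq_one_add_integral one_lt_two (le_refl (0 : ℝ))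
    simp only [zero_div, integral_zero, add_zero] at h0
    rw [h0] at this
    simp only [fadingKernel, prodNe, zero_mul, add_zero, div_one, Finset.prod_const_one,
      ENNReal.ofReal_one, iInf_const, sub_self, mul_zero, neg_zero, Real.exp_zero, mul_one] at this
    rw [lintegral_one, measure_univ]
    exact this.le
  have hle : (fun _ => 1) ≤ᵐ[P] fun ω => ∑' i, {ω | IsClosest x i ω}.indicator (1 : Ω → ℝ≥0∞) ω := by
    filter_upwards [hx.ae_exists_isClosest] with ω ⟨i, hi⟩
    refine le_trans ?_ (ENNReal.le_tsum i)
    rw [Set.indicator_of_mem (by exact hi)]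
    rfl
  have heq := ae_eq_of_ae_le_of_lintegral_le hle (by simp) (Measurable.aemeasurable (.tsum fun i =>
    measurable_one.indicator (hx.measurableSet_isClosest i))) hN
  filter_upwards [heq] with ω hω i j hi hj
  by_contra hij
  have h2 := ENNReal.sum_le_tsum (f := fun i => {ω | IsClosest x i ω}.indicator (1 : Ω → ℝ≥0∞) ω)
    {i, j}
  rw [Finset.sum_pair hij, Set.indicator_of_mem (by exact hi), Set.indicator_of_mem (by exact hj),
    ← hω] at h2
  norm_num [one_add_one_eq_two] at h2

theorem IsRayleighMarkedPPP.coverageClosest_eq (hxg : IsRayleighMarkedPPP P lam x g)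
    (hlam : 0 < lam) (hα : 2 < α) (hθ : 0 < θ) (h : ℝ) :
    coverageClosest P α h x g θ =
      1 / eta α θ 1 1 * Real.exp (-(Real.pi * lam * h ^ 2 * (eta α θ 1 1 - 1))) := by
  have hpos : ∀ᵐ ω ∂P, ∀ i, 0 < ‖x i ω‖ ^ 2 + h ^ 2 := by
    filter_upwards [hxg.ppp.ae_forall_ne_zero] with ω hω i
    have := norm_pos_iff.2 (hω i)
    positivity
  have hAm : ∀ i, MeasurableSet {p : ℕ → Plane | ∀ j, ‖p i‖ ≤ ‖p j‖} := fun i => by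
    simp only [Set.ofPred_forall]
    exact .iInter fun j => measurableSet_le (measurable_pi_apply i).norm (measurable_pi_apply j).norm
  have hm : ∀ i, MeasurableSet {ω | IsClosest x i ω ∧ ENNReal.ofReal θ < sir α h x g i ω} :=
    fun i => (hxg.ppp.measurableSet_isClosest i).inter
      (measurableSet_lt measurable_const (hxg.measurable_sir i))
  have hβ : 1 < α / 2 := by linarith
  have hη := one_le_gaussHypergeometric hβ hθ.le
  -- The events over `i` are disjoint only up to a null set, by almost sure uniqueness of the
  -- closest station.
  rw [coverageClosest, Set.ofPred_exists, measureReal_def, measure_iUnion₀ ?_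
    fun i => (hm i).nullMeasurableSet, eta_eq_one_one]
  · have e : ∀ i, P {ω | IsClosest x i ω ∧ ENNReal.ofReal θ < sir α h x g i ω} =
        ∫⁻ ω, {ω | IsClosest x i ω}.indicator (fun ω => prodNe (fun j =>
          fadingKernel (α / 2) θ (h ^ 2) (‖x i ω‖ ^ 2) (‖x j ω‖ ^ 2)) i) ω ∂P := fun i =>
      hxg.measure_inter_lt_sir hθ hpos (hAm i) i
    have hT := hxg.ppp.isDyadicPoisson.measurable
    have hF : ∀ i, Measurable fun ω => prodNe (fun j =>
        fadingKernel (α / 2) θ (h ^ 2) (‖x i ω‖ ^ 2) (‖x j ω‖ ^ 2)) i := fun i =>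
      measurable_prodNe (fun j => (measurable_fadingKernel _ _ _).comp ((hT i).prodMk (hT j))) i
    rw [tsum_congr e, ← lintegral_tsum fun i =>
      ((hF i).indicator (hxg.ppp.measurableSet_isClosest i)).aemeasurable,
      lintegral_tsum_closestKernel hxg.ppp hlam hβ hθ.le (sq_nonneg h), ENNReal.toReal_ofReal]
    have : 0 < gaussHypergeometric 1 (-(1 / (α / 2))) (1 - 1 / (α / 2)) (-θ) := by linarith
    positivity
  · intro i j hij
    refine measure_mono_null (t := {ω | ¬∀ i j, IsClosest x i ω → IsClosest x j ω → i = j}) ?_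
      (hxg.ppp.ae_isClosest_unique hlam)
    rintro ω ⟨hi, hj⟩ hu
    exact hij (hu i j hi.1 hj.1)

theorem IsRayleighMarkedPPP.meanCoveringStations_eq (hxg : IsRayleighMarkedPPP P lam x g)
    (hlam : 0 < lam) (hα : 2 < α) (hθ : 0 < θ) (hh : 0 < h) :
    meanCoveringStations P α h x g θ =
      ENNReal.ofReal (2 * Real.pi * lam * ∫ r in Set.Ioi h,
        Real.exp (-(Real.pi * lam * h ^ 2 * (eta α (θ * r ^ α) 1 h - 1))) * r) := by
  have hμ : 0 < lam * Real.toNNReal Real.pi := mul_pos hlam (Real.toNNReal_pos.2 Real.pi_pos)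
  have hβ : 1 < α / 2 := by linarith
  have hh2 : 0 < h ^ 2 := by positivity
  have hm : ∀ i, MeasurableSet {ω | ENNReal.ofReal θ < sir α h x g i ω} :=
    fun i => measurableSet_lt measurable_const (hxg.measurable_sir i)
  have e : ∀ i, P {ω | ENNReal.ofReal θ < sir α h x g i ω} = ∫⁻ ω, prodNe (fun j =>
      fadingKernel (α / 2) θ (h ^ 2) (‖x i ω‖ ^ 2) (‖x j ω‖ ^ 2)) i ∂P := fun i => by
    simpa using hxg.measure_inter_lt_sir (α := α) (h := h) hθ (.of_forall fun ω i => by positivity)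
      MeasurableSet.univ i
  have hT := hxg.ppp.isDyadicPoisson.measurable
  have hμπ : Real.pi * lam = ((lam * Real.toNNReal Real.pi : ℝ≥0) : ℝ) := by
    rw [NNReal.coe_mul, Real.coe_toNNReal _ Real.pi_pos.le, mul_comm]
  have hF : ∀ i, Measurable fun ω => prodNe (fun j =>
      fadingKernel (α / 2) θ (h ^ 2) (‖x i ω‖ ^ 2) (‖x j ω‖ ^ 2)) i := fun i =>
    measurable_prodNe (fun j => (measurable_fadingKernel _ _ _).comp ((hT i).prodMk (hT j))) i
  have hN : ∀ ω, (({i : ℕ | ENNReal.ofReal θ < sir α h x g i ω}.encard : ℕ∞) : ℝ≥0∞) =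
      ∑' i, {ω | ENNReal.ofReal θ < sir α h x g i ω}.indicator 1 ω := fun ω => by
    rw [← ENNReal.tsum_set_one, tsum_subtype _ fun _ => 1]
    rfl
  rw [meanCoveringStations, lintegral_congr hN,
    lintegral_tsum fun i => (measurable_one.indicator (hm i)).aemeasurable,
    tsum_congr fun i => (lintegral_indicator_one (hm i)).trans (e i),
    ← lintegral_tsum fun i => (hF i).aemeasurable,
    lintegral_tsum_prodNe hxg.ppp.isDyadicPoisson
      (isMonotoneKernel_fadingKernel (by linarith) hθ.le hh2) fun s hs => by
        rw [lintegral_one_sub_fadingKernel hβ hθ.le hh2 hs]; exact ENNReal.ofReal_ne_top,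
    lintegral_exp_fadingKernel hα hθ hh hμ, mul_assoc 2 Real.pi, hμπ]

end

end

theorem mainTheorem4 {Ω : Type*} [MeasurableSpace Ω] (P : Measure Ω) [IsProbabilityMeasure P]
    (lam : ℝ≥0) (hlam : 0 < lam) (α : ℝ) (hα : 2 < α) (θ : ℝ) (hθ : 0 < θ)
    (x : ℕ → Ω → Plane) (g : ℕ → Ω → ℝ) (hxg : IsRayleighMarkedPPP P lam x g) :
    (∀ h : ℝ, 0 ≤ h →
      coverageClosest P α h x g θ =
        1 / eta α θ 1 1 * Real.exp (-(Real.pi * lam * h ^ 2 * (eta α θ 1 1 - 1)))) ∧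
    (∀ h : ℝ, 0 < h →
      IntegrableOn
        (fun r : ℝ => Real.exp (-(Real.pi * lam * h ^ 2 * (eta α (θ * r ^ α) 1 h - 1))) * r)
        (Set.Ioi h) ∧
      meanCoveringStations P α h x g θ =
        ENNReal.ofReal (2 * Real.pi * lam * ∫ r in Set.Ioi h,
          Real.exp (-(Real.pi * lam * h ^ 2 * (eta α (θ * r ^ α) 1 h - 1))) * r) ∧
      (1 ≤ θ →
        coverageStrongest P α h x g θ =
          2 * Real.pi * lam * ∫ r in Set.Ioi h,
            Real.exp (-(Real.pi * lam * h ^ 2 * (eta α (θ * r ^ α) 1 h - 1))) * r)) := by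
  have e : ∀ I : ℝ, 0 ≤ I → (0 : ℝ) ≤ 2 * Real.pi * lam * I := fun I hI => by positivity
  refine ⟨fun h _ => hxg.coverageClosest_eq hlam hα hθ h, fun h hh => ?_⟩
  have hmean := hxg.meanCoveringStations_eq hlam hα hθ hh
  refine ⟨?_, hmean, fun hθ1 => ?_⟩
  · have hμ : 0 < lam * Real.toNNReal Real.pi := mul_pos hlam (Real.toNNReal_pos.2 Real.pi_pos)
    have hi := integrableOn_exp_eta hα hθ hh hμ
    rwa [NNReal.coe_mul, Real.coe_toNNReal _ Real.pi_pos.le, mul_comm (lam : ℝ)] at hi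
  · rw [hxg.coverageStrongest_eq hθ1, hmean, ENNReal.toReal_ofReal]
    refine e _ (setIntegral_nonneg measurableSet_Ioi fun r hr => ?_)
    have : 0 < r := hh.trans hr
    positivity
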